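/- **Splay-list.** A splay-list stores objects with distinct keys from a linear order in sorted lists indexed by heights $0,1,2,\dots$; the list at height $0$ contains all physically present objects (some of which may be marked as deleted), and each higher list contains a subset of the one below it. The height $h_u$ of an object $u$ is the index of the highest list containing it. Sentinels head and tail belong to all lists, and head has one hit. Every object $u$ carries a counter $sh'_u$; let $m'=\sum_u sh'_u$ and $k=\lfloor\log_2 m'\rfloor$; the topmost list, at height $k+1$, contains the sentinels only. For a set $S$ of objects, $hits(S)$ is the sum of their counters. The subtree $C^h_u$ of an object $u$ with $h_u\ge h$ consists of $u$ and of all objects between $u$ and the next object of height at least $h$. *Search* is the skip-list search from the top list, which stops at the object with the requested key. *Balancing* walks back along the search path, starting at the target. At an object $u$ with nearest predecessor $v$ (possibly head) of height at least $h_u$: (i) if $hits(C^{h_u}_u)+hits(C^{h_u}_v)\le m'/2^{k-h_u}$, then $u$ is demoted by one level and the walk continues at $v$; (ii) otherwise, if $\sum_{x\in S_u} hits(C^{h_u}_x)>m'/2^{k-h_u-1}$, where $S_u$ is the set of objects of height $h_u$ from $u$ up to the next object of height greater than $h_u$, then $u$ is promoted by one level and checked again; (iii) otherwise the walk continues at $v$.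 Whenever $\lfloor \log_2 m'\rfloor$ increases, a new bottom list containing all objects is added (expansion) before balancing. The operations are contains, insert and delete. An operation whose key is physically present visits the corresponding object; insert then unmarks it and delete marks it as deleted. An insert whose key is physically absent links a new object with counter $1$ into the bottom list. These two kinds of operations are the *hit-operations*; all other operations change nothing. When the counters of the marked objects sum up to at least half of $m'$, a new splay-list is built from the non-marked objects, with their counters, by recursively choosing in each segment with $H$ hits in total the object in the middle, by hits, of the segment, and giving it height $\lfloor\log_2 H\rfloor$. **Relaxed algorithm.** Fix a real $c\ge 1$. A hit-operation on a physically present object increments the counter and performs the balancing only with probability $1/c$, independently of everything else; an insert that links a new object always balances. **Time.** Each link followed or level descended in the search, each object visited (with its checks, and its promotion or demotion) in the backward pass, each entry of the list added in an expansion, and, in a rebuild, each object or array cell (one per hit of the kept objects) read or written, each recursive call and each insertion into a list costs one step. Each hit-operation has one further step. **Theorem.** In the relaxed algorithm a hit-operation on $u$ takes expected amortized $O\!\left(c\left(1+\log\frac{m}{sh_u}\right)\right)$ time, where $m$ is the true total number of hit-operations performed so far on the objects physically present in the splay-list, and $sh_u$ is the true number of those performed on $u$, both including the operation itself. That is, there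 is an absolute constant $C$ such that for every $c\ge 1$, every fixed sequence of operations starting from the empty splay-list and every $n$, the expected total time of the hit-operations among the first $n$ operations is finite and at most $$\mathbb E\left[\ \sum_{\substack{i\le n\\ i\text{-th operation is a hit-operation}}} C\,c\left(1+\log_2\frac{m_i}{sh_i}\right)\right],$$ where $m_i$ and $sh_i$ are the values of $m$ and $sh_u$ at the $i$-th operation, and $u$ is its object. -/

import Mathlib

open MeasureTheory ProbabilityTheory

namespace SplayList

/-- An object that is physically present in the splay-list.
`height` is the index of the highest sub-list containing it (the bottom list has index `0`),
`hits` is the relaxed counter maintained by the algorithm, `deleted` is the logical deletion mark.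
`trueHits` is the exact number of hit-operations performed on the object; it is only
bookkeeping for the analysis and the algorithm never reads it. -/
structure Node (K : Type*) where
  key : K
  height : ℕ
  hits : ℕ
  trueHits : ℕ
  deleted : Bool

/-- A splay-list is the bottom list, i.e. all physically present objects from left to right.
The sub-list at height `h` consists of the objects of height at least `h`. The sentinels `head` and
`tail` belong to every sub-list; they are implicit at the two ends of the list. -/
abbrev State (K : Type*) := List (Node K)

/-- Sum of the relaxed hit counters. On a whole splay-list this is the relaxed counter `m'`. -/
def totalHits {K : Type*} (s : List (Node K)) : ℕ := (s.map Node.hits).sum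

/-- Sum of the exact hit counts. On a whole splay-list this is `m`. -/
def totalTrueHits {K : Type*} (s : List (Node K)) : ℕ := (s.map Node.trueHits).sum

/-- The part of `totalHits` that belongs to logically deleted objects. -/
def deletedHits {K : Type*} (s : List (Node K)) : ℕ := totalHits (s.filter (fun x => x.deleted))

/-- The topmost height `k = ⌊log₂ m'⌋` that objects can have; the sentinel sub-list, which
contains only `head` and `tail`, has index `k + 1`. -/
def topLevel {K : Type*} (s : State K) : ℕ := Nat.log 2 (totalHits s)

/-! ### The forward pass -/

/-- The place where a search ended: the objects to the left (nearest first), the object with the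
requested key if it was found, the objects to the right (nearest first), and the number of steps. -/
structure Located (K : Type*) where
  left : List (Node K)
  found : Option (Node K)
  right : List (Node K)
  steps : ℕ

/-- One more step. -/
def Located.tick {K : Type*} (p : Located K) : Located K := { p with steps := p.steps + 1 }

/-- The search for `t`, standing in the sub-list of height `h` right after the objects `L`
(nearest first) and before the objects `R`. The next object of the sub-list is the first one in `R`
of height at least `h`. The search moves on to it if its key is at most `t` (and stops there
if its key is `t`); otherwise it descends to the next lower sub-list, and fails if there is none.
Following a link and descending a level cost one step each. -/
def search {K : Type*} [LinearOrder K] (t : K) (h : ℕ) (L R : List (Node K)) : Located K :=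
  match _hR : R.dropWhile (fun x => x.height < h) with
  | x :: R' =>
    if x.key = t then
      ⟨(R.takeWhile (fun x => x.height < h)).reverse ++ L, some x, R', 1⟩
    else if x.key < t then
      (search t h (x :: ((R.takeWhile (fun x => x.height < h)).reverse ++ L)) R').tick
    else
      match h with
      | 0 => ⟨L, none, R, 1⟩
      | h' + 1 => (search t h' L R).tick
  | [] =>
    match h with
    | 0 => ⟨L, none, R, 1⟩
    | h' + 1 => (search t h' L R).tick
termination_by (R.length, h)
decreasing_by
  · have h1 := (List.dropWhile_sublist (fun x : Node K => decide (x.height < h)) (l := R)).length_le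
    rw [_hR] at h1
    simp only [List.length_cons] at h1
    exact Prod.Lex.left _ _ (by omega)
  · exact Prod.Lex.right _ (by omega)
  · exact Prod.Lex.right _ (by omega)

/-! ### The backward pass -/

/-- `hits(C^h_u)` for the object `u` of height at least `h`, where `R` are the objects to the right of
`u`: the subtree of `u` at height `h` is `u` together with all objects before the next object of
height at least `h`. -/
def subtreeHits {K : Type*} (h : ℕ) (u : Node K) (R : List (Node K)) : ℕ :=
  u.hits + totalHits (R.takeWhile (fun x => x.height < h))

/-- `hits(C^h_v)` for the predecessor `v` at height `h` of an object of height at least `h`,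
where `L` are the objects to the left of the latter, nearest first.
The predecessor is the nearest object of height at least `h`, or `head`, which has one hit. -/
def predSubtreeHits {K : Type*} (h : ℕ) (L : List (Node K)) : ℕ :=
  totalHits (L.takeWhile (fun x => x.height < h)) +
    match L.dropWhile (fun x => x.height < h) with
    | [] => 1
    | v :: _ => v.hits

/-- The sum of `hits(C^{h_u}_x)` over all objects `x ∈ S_u`, that is, over the objects `x` of height
`h_u` in the interval `[u, w)`, where `w` is the first object to the right of `u` of height strictly
greater than `h_u`. The subtrees partition the interval, so this is the interval sum. -/
def ascentPotential {K : Type*} (u : Node K) (R : List (Node K)) : ℕ :=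
  u.hits + totalHits (R.takeWhile (fun x => x.height ≤ u.height))

/-- Descent condition `hits(C^{h_u}_u) + hits(C^{h_u}_v) ≤ m' / 2 ^ (k - h_u)`, multiplied by `2 ^ k`.
-/
def DescentCondition {K : Type*} (m k : ℕ) (L : List (Node K)) (u : Node K) (R : List (Node K)) :
    Prop :=
  (subtreeHits u.height u R + predSubtreeHits u.height L) * 2 ^ k ≤ m * 2 ^ u.height

/-- Ascent condition `∑ x ∈ S_u, hits(C^{h_u}_x) > m' / 2 ^ (k - h_u - 1)`, multiplied by `2 ^ k`.
The height of an object never exceeds `k`. -/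
def AscentCondition {K : Type*} (m k : ℕ) (u : Node K) (R : List (Node K)) : Prop :=
  u.height < k ∧ m * 2 ^ (u.height + 1) < ascentPotential u R * 2 ^ k

instance {K : Type*} (m k : ℕ) (L : List (Node K)) (u : Node K) (R : List (Node K)) :
    Decidable (DescentCondition m k L u R) :=
  inferInstanceAs (Decidable (_ ≤ _))

instance {K : Type*} (m k : ℕ) (u : Node K) (R : List (Node K)) :
    Decidable (AscentCondition m k u R) :=
  inferInstanceAs (Decidable (_ ∧ _))

/-- The backward traversal, standing at the object `u` with the objects `L` (nearest first) to its
left and `R` to its right. If `u` satisfies the descent condition, it is demoted and the traversal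
continues at its predecessor `v`. Otherwise, if `u` satisfies the ascent condition,
it is promoted and the traversal continues from `u` itself. Otherwise the traversal
continues at `v`. It ends at `head`. The result is the new bottom list and the number of steps,
where visiting an object, with the checks and the promotion or demotion there, is one step
(the sums in the conditions are available in constant time, because every object stores
`hits(C^h_u)` for its heights `h` and these counters change only along the path). -/
def balance {K : Type*} (m k : ℕ) (L : List (Node K)) (u : Node K) (R : List (Node K)) :
    State K × ℕ :=
  if AscentCondition m k u R ∧ ¬ DescentCondition m k L u R then
    let r := balance m k L { u with height := u.height + 1 } R
    (r.1, r.2 + 1)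
  else
    let u' : Node K :=
      if DescentCondition m k L u R then { u with height := u.height - 1 } else u
    let R' : List (Node K) := (L.takeWhile (fun x => x.height < u.height)).reverse ++ u' :: R
    match hL : L.dropWhile (fun x => x.height < u.height) with
    | [] => (R', 1)
    | v :: L' =>
      let r := balance m k L' v R'
      (r.1, r.2 + 1)
termination_by (L.length, k - u.height)
decreasing_by
  · rename_i h
    have h1 : u.height < k := h.1.1
    exact Prod.Lex.right _ (by omega)
  · have h1 :=
      (List.dropWhile_sublist (fun x : Node K => decide (x.height < u.height)) (l := L)).length_le
    rw [hL] at h1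
    simp only [List.length_cons] at h1
    exact Prod.Lex.left _ _ (by omega)

/-- Expansion: a new bottom list containing all objects is added, so all heights grow by one. -/
def expand {K : Type*} (s : List (Node K)) : List (Node K) :=
  s.map (fun x => { x with height := x.height + 1 })

/-- Balancing after the relaxed counter of `u` has been increased by one (or `u` has been linked into
the bottom list with counter one): the splay-list is expanded if `⌊log₂ m'⌋` has increased, at the
cost of one step for every entry of the new list, sentinels included; then the backward pass
starts at `u`. -/
def rebalance {K : Type*} (L : List (Node K)) (u : Node K) (R : List (Node K)) : State K × ℕ :=
  let m := totalHits L + u.hits + totalHits R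
  let k := Nat.log 2 m
  if Nat.log 2 (m - 1) < k then
    let r := balance m k (expand L) { u with height := u.height + 1 } (expand R)
    (r.1, r.2 + (L.length + 1 + R.length + 2))
  else balance m k L u R

/-! ### Rebuilding -/

/-- The number of objects to the left of the one that occupies cell number `r` (counting from one)
of the array that contains every object as many times as it has hits, in order. -/
def splitIndex {K : Type*} (r : ℕ) : List (Node K) → ℕ
  | [] => 0
  | x :: xs => if r ≤ x.hits then 0 else splitIndex (r - x.hits) xs + 1

/-- The recursive construction on a contiguous segment with `H` hits in total. The object in the middle
cell `⌈H / 2⌉` is put into the lowest `p` sub-lists, where `2 ^ (p - 1) ≤ H < 2 ^ p` (so its height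
is `p - 1 = ⌊log₂ H⌋`), and the two remaining parts are treated in the same way. A call
costs one step, and so does every insertion into a sub-list. -/
def build {K : Type*} (s : List (Node K)) : State K × ℕ :=
  match hs : s.drop (splitIndex ((totalHits s + 1) / 2) s) with
  | [] => (s, 1)
  | x :: right =>
    let a := build (s.take (splitIndex ((totalHits s + 1) / 2) s))
    let b := build right
    let h := Nat.log 2 (totalHits s)
    (a.1 ++ { x with height := h } :: b.1, a.2 + b.2 + (h + 1) + 1)
termination_by s.length
decreasing_by
  · have h1 := congrArg List.length hs
    simp only [List.length_drop, List.length_cons] at h1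
    simp only [List.length_take]
    omega
  · have h1 := congrArg List.length hs
    simp only [List.length_drop, List.length_cons] at h1
    omega

/-- When the logically deleted objects account for at least half of the (relaxed) hits, a new
splay-list is built from the other objects. Reading the old bottom list costs one step per
object and filling the array used by the construction costs one step per cell. -/
def cleanup {K : Type*} (s : State K) : State K × ℕ :=
  if 0 < totalHits s ∧ totalHits s ≤ 2 * deletedHits s then
    let s' := s.filter (fun x => !x.deleted)
    let r := build s'
    (r.1, s.length + totalHits s' + r.2)
  else (s, 0)

/-! ### Operations -/

/-- The operations of the interface. -/
inductive Op (K : Type*) where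
  | contains (t : K)
  | insert (t : K)
  | delete (t : K)

/-- The argument of an operation. -/
def Op.key {K : Type*} : Op K → K
  | .contains t => t
  | .insert t => t
  | .delete t => t

/-- The new deletion mark of a physically present object, as a function of the old one. -/
def Op.mark {K : Type*} : Op K → Bool → Bool
  | .contains _, b => b
  | .insert _, _ => false
  | .delete _, _ => true

/-- The outcome of an operation: the new splay-list, the number of steps, and, for a hit-operation on
`u`, the pair `(m, sh_u)`, where `m` is the number of hit-operations performed so far on
all objects present in the splay-list and `sh_u` is the number of those performed on `u`
(both exact and both including the operation itself). -/
structure Outcome (K : Type*) where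
  state : State K
  steps : ℕ
  hit : Option (ℕ × ℕ)

/-- One operation of the relaxed sequential algorithm. If the search finds a (possibly marked) object
with the requested key, this is a hit-operation: the mark is set as required, and if `coin` is true
the relaxed counters are updated and the balancing is performed. If the key is
physically absent, `insert` links a new object with counter one into the bottom list and always
balances (this is also a hit-operation), while the other operations end without effect. -/
def step {K : Type*} [LinearOrder K] (coin : Bool) (op : Op K) (s : State K) : Outcome K :=
  let p := search op.key (topLevel s + 1) [] s
  match p.found with
  | some x =>
    let u : Node K := { x with trueHits := x.trueHits + 1, deleted := op.mark x.deleted }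
    let r : State K × ℕ :=
      if coin then rebalance p.left { u with hits := u.hits + 1 } p.right
      else (p.left.reverse ++ u :: p.right, 0)
    let q := cleanup r.1
    ⟨q.1, p.steps + 1 + r.2 + q.2, some (totalTrueHits r.1, u.trueHits)⟩
  | none =>
    match op with
    | .insert t =>
      let r := rebalance p.left ⟨t, 0, 1, 1, false⟩ p.right
      let q := cleanup r.1
      ⟨q.1, p.steps + 1 + r.2 + q.2, some (totalTrueHits r.1, 1)⟩
    | _ => ⟨s, p.steps, none⟩

/-- The splay-list after the first `i` operations, starting from the empty one. -/
def stateAt {K : Type*} [LinearOrder K] (op : ℕ → Op K) (coin : ℕ → Bool) : ℕ → State K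
  | 0 => []
  | i + 1 => (step (coin i) (op i) (stateAt op coin i)).state

/-- The outcome of operation number `i` (counting from zero). -/
def outcomeAt {K : Type*} [LinearOrder K] (op : ℕ → Op K) (coin : ℕ → Bool) (i : ℕ) : Outcome K :=
  step (coin i) (op i) (stateAt op coin i)

/-- The time of an operation if it is a hit-operation. Other operations do not change the
splay-list, and their time is not counted. -/
def Outcome.hitTime {K : Type*} (o : Outcome K) : ℝ :=
  match o.hit with
  | some _ => (o.steps : ℝ)
  | none => 0

/-- `1 + log₂ (m / sh_u)` for a hit-operation on `u`. -/
noncomputable def Outcome.hitBound {K : Type*} (o : Outcome K) : ℝ :=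
  match o.hit with
  | some (m, sh) => 1 + Real.logb 2 ((m : ℝ) / (sh : ℝ))
  | none => 0

end SplayList

/-!
The proof is an amortized analysis with a potential that is a supermartingale up to the claimed bound.

*Deterministic part.* The invariant `NoAscent` says that no object may be promoted: the interval of `x`,
from `x` to the next higher object, has at most `m' / 2 ^ (k - h_x - 1)` hits. Hence the depth
`k - h_x` is at most `1 + log₂ (m' / sh'_x)`. The search visits the objects that the walk back
from its end meets (`search_spec`), and the backward pass visits the same ones, since a promoted
object is never preceded on the path by one of its original height
(`BalanceInv.lt_height_of_ascent`). On each level only boundedly many of them are neither demoted nor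
promoted, because the descent condition fails at each of these while the interval of the last one is
light; demotions are paid for by the sum of the heights (`balance_cost`). Expansions are paid for by
`2 * m' - 2 ^ (k + 1)`, and rebuildings, which take linear time (`build_cost`) and at least halve
`m'`, by a multiple of `m'`. So a balancing hit-operation has amortized cost `O(1 + k - h_u)`
(`hitCost_of_found`, `linkCost_of_absent`).

*Probabilistic part.* The search on a present object does not depend on the coin of its operation, so that
its cost can be charged, with a factor `c`, to the event that the coin shows heads. This
replaces `c * cost` by an expectation and leaves a bound in terms of `log₂ (m' / sh')`, which exceeds
`log₂ (m / sh)` by at most `log₂ (sh / sh') ≤ 2 * (sh / sh')`. The latter is paid for by the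
second potential `lag = ∑ sh² / sh'`: a hit with a coin of probability `1 / c` changes it by at most
`8 * c - sh / sh'` in expectation (`lag_drift`), and removing an object only decreases it.
Altogether the expected excess of an operation over the bound is nonpositive in every state
(`excess_nonpos`). The state is a function of the earlier coins, so the coin of the operation can be
averaged out (`integral_coins_nonpos`), and summing over the operations gives the theorem. The
order of the keys is not needed anywhere.
-/

namespace SplayList

variable {K : Type*}

/-! ### Totals over lists of objects -/

/-- The sum of the heights of the objects. -/
def totalHeight (s : List (Node K)) : ℕ := (s.map Node.height).sum

/-- The hits of the longest prefix of `R` whose objects have height at most `h`. -/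
def prefixHits (h : ℕ) (R : List (Node K)) : ℕ := totalHits (R.takeWhile (fun x => x.height ≤ h))

@[simp] lemma totalHits_nil : totalHits ([] : List (Node K)) = 0 := rfl

@[simp] lemma totalHits_cons (x : Node K) (s : List (Node K)) :
    totalHits (x :: s) = x.hits + totalHits s := by simp [totalHits]

@[simp] lemma totalHits_append (s t : List (Node K)) :
    totalHits (s ++ t) = totalHits s + totalHits t := by simp [totalHits]

@[simp] lemma totalHits_reverse (s : List (Node K)) : totalHits s.reverse = totalHits s := by
  simp [totalHits, List.sum_reverse]

@[simp] lemma totalHeight_nil : totalHeight ([] : List (Node K)) = 0 := rfl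

@[simp] lemma totalHeight_cons (x : Node K) (s : List (Node K)) :
    totalHeight (x :: s) = x.height + totalHeight s := by simp [totalHeight]

@[simp] lemma totalHeight_append (s t : List (Node K)) :
    totalHeight (s ++ t) = totalHeight s + totalHeight t := by simp [totalHeight]

@[simp] lemma totalHeight_reverse (s : List (Node K)) :
    totalHeight s.reverse = totalHeight s := by
  simp [totalHeight, List.sum_reverse]

@[simp] lemma prefixHits_nil (h : ℕ) : prefixHits h ([] : List (Node K)) = 0 := rfl

lemma prefixHits_cons (h : ℕ) (x : Node K) (R : List (Node K)) :
    prefixHits h (x :: R) = if x.height ≤ h then x.hits + prefixHits h R else 0 := by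
  by_cases hx : x.height ≤ h <;> simp [prefixHits, hx]

lemma prefixHits_append {h : ℕ} {A : List (Node K)} (hA : ∀ x ∈ A, x.height ≤ h)
    (R : List (Node K)) : prefixHits h (A ++ R) = totalHits A + prefixHits h R := by
  induction A with
  | nil => simp
  | cons x A ih =>
    simp only [List.mem_cons, forall_eq_or_imp] at hA
    simp [prefixHits_cons, hA.1, ih hA.2, add_assoc]

lemma prefixHits_le_totalHits (h : ℕ) (R : List (Node K)) : prefixHits h R ≤ totalHits R := by
  induction R with
  | nil => simp
  | cons x R ih => rw [prefixHits_cons, totalHits_cons]; split_ifs <;> omega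

lemma ascentPotential_eq (u : Node K) (R : List (Node K)) :
    ascentPotential u R = u.hits + prefixHits u.height R := rfl

lemma takeWhile_lt_succ (h : ℕ) (R : List (Node K)) :
    totalHits (R.takeWhile (fun x => x.height < h + 1)) = prefixHits h R := by
  simp [prefixHits]

lemma subtreeHits_succ (h : ℕ) (u : Node K) (R : List (Node K)) :
    subtreeHits (h + 1) u R = u.hits + prefixHits h R := by
  rw [subtreeHits, takeWhile_lt_succ]

lemma subtreeHits_le_ascentPotential (u : Node K) (R : List (Node K)) :
    subtreeHits u.height u R ≤ ascentPotential u R := by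
  rw [subtreeHits, ascentPotential_eq]
  cases h : u.height with
  | zero => cases R <;> simp
  | succ n =>
    rw [takeWhile_lt_succ]
    induction R with
    | nil => simp
    | cons x R ih =>
      simp only [prefixHits_cons]
      split_ifs <;> omega

lemma subtreeHits_append {h : ℕ} {A : List (Node K)} (hA : ∀ x ∈ A, x.height < h)
    (v : Node K) (R : List (Node K)) :
    subtreeHits h v (A ++ R) = totalHits A + subtreeHits h v R := by
  cases h with
  | zero => cases A with
    | nil => simp
    | cons x A => exact absurd (hA x (by simp)) (Nat.not_lt_zero _)
  | succ h =>
    rw [subtreeHits_succ, subtreeHits_succ, prefixHits_append (fun x hx => by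
      have := hA x hx; omega)]
    omega

/-! ### The path to an object -/

/-- The number of objects that the walk back to `head` visits when it starts right after the objects
`L` (nearest first) at height `h` and always proceeds to the nearest object that is at
least as high as the present one. -/
def pathLength : ℕ → List (Node K) → ℕ
  | _, [] => 0
  | h, y :: L => if h ≤ y.height then pathLength y.height L + 1 else pathLength h L

lemma pathLength_append {h : ℕ} {A : List (Node K)} (hA : ∀ x ∈ A, x.height < h)
    (L : List (Node K)) : pathLength h (A ++ L) = pathLength h L := by
  induction A with
  | nil => rfl
  | cons x A ih =>
    simp only [List.mem_cons, forall_eq_or_imp] at hA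
    simp [pathLength, not_le.2 hA.1, ih hA.2]

lemma pathLength_cons {h : ℕ} {v : Node K} (hv : h ≤ v.height) (L : List (Node K)) :
    pathLength h (v :: L) = pathLength v.height L + 1 := by
  simp [pathLength, hv]

lemma pathLength_congr {h h' : ℕ} {L : List (Node K)}
    (hL : ∀ y ∈ L.head?, h ≤ y.height ∧ h' ≤ y.height) : pathLength h L = pathLength h' L := by
  cases L with
  | nil => rfl
  | cons y L =>
    have := hL y (by simp)
    rw [pathLength_cons this.1, pathLength_cons this.2]

lemma mem_takeWhile_height_lt {h : ℕ} {L : List (Node K)} {x : Node K}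
    (hx : x ∈ L.takeWhile (fun x => x.height < h)) : x.height < h := by
  simpa using List.mem_takeWhile_imp hx

lemma le_height_of_dropWhile {h : ℕ} {L L' : List (Node K)} {v : Node K}
    (hL : L.dropWhile (fun x => x.height < h) = v :: L') : h ≤ v.height := by
  have := List.head?_dropWhile_not (fun x : Node K => decide (x.height < h)) L
  simpa [hL] using this

lemma takeWhile_append_of_dropWhile {h : ℕ} {L L' : List (Node K)}
    (hL : L.dropWhile (fun x => x.height < h) = L') :
    L.takeWhile (fun x => x.height < h) ++ L' = L := by
  rw [← hL, List.takeWhile_append_dropWhile]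

/-! ### The cost of the forward pass -/

section Search

@[simp] lemma Located.tick_left (p : Located K) : p.tick.left = p.left := rfl
@[simp] lemma Located.tick_found (p : Located K) : p.tick.found = p.found := rfl
@[simp] lemma Located.tick_right (p : Located K) : p.tick.right = p.right := rfl
@[simp] lemma Located.tick_steps (p : Located K) : p.tick.steps = p.steps + 1 := rfl

/-- The specification of the outcome `p` of a search that stands between `L` and `R` in the sub-list
of height `h`: the objects visited by the search are exactly the objects that the walk
back from the place where it ended will meet. -/
def SearchSpec (h : ℕ) (L R : List (Node K)) (p : Located K) : Prop :=
  match p.found with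
  | some x => x.height ≤ h ∧ p.left.reverse ++ x :: p.right = L.reverse ++ R ∧
      p.steps + pathLength h L = pathLength x.height p.left + (h - x.height) + 1
  | none => p.left.reverse ++ p.right = L.reverse ++ R ∧
      p.steps + pathLength h L = pathLength 0 p.left + h + 1

variable [LinearOrder K]

lemma search_of_key_eq {t : K} {h : ℕ} {L R R' : List (Node K)} {x : Node K}
    (hR : R.dropWhile (fun x => x.height < h) = x :: R') (hx : x.key = t) :
    search t h L R = ⟨(R.takeWhile (fun x => x.height < h)).reverse ++ L, some x, R', 1⟩ := by
  rw [search]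
  split <;> rename_i heq
  · rw [hR] at heq; cases heq; rw [if_pos hx]
  · rw [hR] at heq; cases heq

lemma search_of_key_lt {t : K} {h : ℕ} {L R R' : List (Node K)} {x : Node K}
    (hR : R.dropWhile (fun x => x.height < h) = x :: R') (hx : x.key < t) :
    search t h L R =
      (search t h (x :: ((R.takeWhile (fun x => x.height < h)).reverse ++ L)) R').tick := by
  rw [search]
  split <;> rename_i heq
  · rw [hR] at heq; cases heq; rw [if_neg hx.ne, if_pos hx]
  · rw [hR] at heq; cases heq

lemma search_zero_of_lt {t : K} {L R : List (Node K)}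
    (hR : ∀ x ∈ (R.dropWhile (fun x => x.height < 0)).head?, t < x.key) :
    search t 0 L R = ⟨L, none, R, 1⟩ := by
  rw [search]
  split <;> rename_i heq
  · have := hR _ (by rw [heq]; rfl)
    rw [if_neg this.ne', if_neg this.not_gt]
  · rfl

lemma search_succ_of_lt {t : K} {h : ℕ} {L R : List (Node K)}
    (hR : ∀ x ∈ (R.dropWhile (fun x => x.height < h + 1)).head?, t < x.key) :
    search t (h + 1) L R = (search t h L R).tick := by
  rw [search]
  split <;> rename_i heq
  · have := hR _ (by rw [heq]; rfl)
    rw [if_neg this.ne', if_neg this.not_gt]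
  · rfl

lemma search_spec (t : K) (h : ℕ) (L R : List (Node K))
    (hL : ∀ y ∈ L.head?, h ≤ y.height)
    (hR : ∀ z ∈ (R.dropWhile (fun x => x.height < h + 1)).head?, t < z.key) :
    SearchSpec h L R (search t h L R) := by
  by_cases hcase : ∀ x ∈ (R.dropWhile (fun x => x.height < h)).head?, t < x.key
  · cases h with
    | zero =>
      rw [search_zero_of_lt hcase]
      simp [SearchSpec, add_comm]
    | succ h =>
      rw [search_succ_of_lt hcase]
      have ih := search_spec t h L R (fun y hy => (Nat.le_succ h).trans (hL y hy)) hcase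
      have hp : pathLength (h + 1) L = pathLength h L :=
        pathLength_congr fun y hy => ⟨hL y hy, (Nat.le_succ h).trans (hL y hy)⟩
      unfold SearchSpec at ih ⊢
      simp only [Located.tick_found, Located.tick_left, Located.tick_right, Located.tick_steps]
      split at ih
      · obtain ⟨h1, h2, h3⟩ := ih
        exact ⟨by omega, h2, by omega⟩
      · obtain ⟨h2, h3⟩ := ih
        exact ⟨h2, by omega⟩
  · push Not at hcase
    obtain ⟨x, hx, hxt⟩ := hcase
    obtain ⟨R', hR'⟩ : ∃ R', R.dropWhile (fun x => x.height < h) = x :: R' := by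
      cases hd : R.dropWhile (fun x => x.height < h) with
      | nil => simp [hd] at hx
      | cons y R' => simp [hd] at hx; exact ⟨R', by rw [hx]⟩
    have hlow : ∀ y ∈ R.takeWhile (fun x => x.height < h), y.height < h := fun y hy =>
      mem_takeWhile_height_lt hy
    have hsplit := takeWhile_append_of_dropWhile hR'
    have hxh := le_height_of_dropWhile hR'
    set A := R.takeWhile (fun x => x.height < h) with hA
    have hdrop : ∀ B : List (Node K), (A ++ B).dropWhile (fun x => x.height < h + 1) =
        B.dropWhile (fun x => x.height < h + 1) := fun B =>
      List.dropWhile_append_of_pos fun y hy => by have := hlow y hy; simp; omega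
    -- a higher object than the present level would already have stopped the search one level above
    have hxe : x.height = h := by
      by_contra hne
      have hlt : ¬ x.height < h + 1 := by omega
      rw [← hsplit, hdrop, List.dropWhile_cons_of_neg (by simpa using hlt)] at hR
      exact absurd (hR x rfl) hxt.not_gt
    have hpath : ∀ B, pathLength h (A.reverse ++ B) = pathLength h B := fun B =>
      pathLength_append (fun y hy => hlow y (by simpa using hy)) B
    rcases hxt.eq_or_lt with heq | hlt
    · rw [search_of_key_eq hR' heq]
      simp only [SearchSpec, ← hA, List.reverse_append, List.reverse_reverse, List.append_assoc]
      refine ⟨hxe.le, by rw [hsplit], ?_⟩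
      rw [hxe, hpath]; omega
    · rw [search_of_key_lt hR' hlt, ← hA]
      have hlen : R'.length < R.length := by rw [← hsplit]; simp; omega
      have ih := search_spec t h (x :: (A.reverse ++ L)) R' (by simp [hxe]) (by
        rw [← hsplit, hdrop, List.dropWhile_cons_of_pos (by simp [hxe])] at hR
        exact hR)
      have hp : pathLength h (x :: (A.reverse ++ L)) = pathLength h L + 1 := by
        rw [pathLength_cons hxh, hxe, hpath]
      have hlist : (x :: (A.reverse ++ L)).reverse ++ R' = L.reverse ++ R := by
        rw [← hsplit]; simp
      rw [SearchSpec, hp, hlist] at ih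
      unfold SearchSpec
      simp only [Located.tick_found, Located.tick_left, Located.tick_right, Located.tick_steps]
      split at ih
      · obtain ⟨h1, h2, h3⟩ := ih
        exact ⟨h1, h2, by omega⟩
      · obtain ⟨h2, h3⟩ := ih
        exact ⟨h2, by omega⟩
termination_by (R.length, h)
decreasing_by
  · exact Prod.Lex.right _ (by omega)
  · exact Prod.Lex.left _ _ hlen

end Search

/-! ### Objects without their heights -/

/-- The object with its height forgotten. -/
def Node.bare (x : Node K) : Node K := { x with height := 0 }

lemma totalHits_map_bare (s : List (Node K)) : totalHits (s.map Node.bare) = totalHits s := by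
  simp [totalHits, Node.bare, Function.comp_def]

lemma totalHits_congr {s t : List (Node K)} (h : s.map Node.bare = t.map Node.bare) :
    totalHits s = totalHits t := by
  rw [← totalHits_map_bare s, h, totalHits_map_bare]

lemma totalTrueHits_congr {s t : List (Node K)} (h : s.map Node.bare = t.map Node.bare) :
    totalTrueHits s = totalTrueHits t := by
  have key : ∀ s : List (Node K), totalTrueHits (s.map Node.bare) = totalTrueHits s := fun s => by
    simp [totalTrueHits, Node.bare, Function.comp_def]
  rw [← key s, h, key]

/-! ### The ascent invariant -/

/-- The object `x`, followed by the objects `B`, has height at most `k`, and the sum in its ascent condition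
does not exceed `m / 2 ^ (k - h_x - 1)`. -/
def AscentOk (m k : ℕ) (x : Node K) (B : List (Node K)) : Prop :=
  x.height ≤ k ∧ ascentPotential x B * 2 ^ k ≤ m * 2 ^ (x.height + 1)

/-- No object of the list has too many hits in its interval for its height, and all heights are at most
`k`. -/
def NoAscent (m k : ℕ) : List (Node K) → Prop
  | [] => True
  | x :: B => AscentOk m k x B ∧ NoAscent m k B

/-- `NoAscent` for the objects of `L` (listed from right to left) when `T` follows them. -/
def NoAscentLeft (m k : ℕ) : List (Node K) → List (Node K) → Prop
  | [], _ => True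
  | y :: L, T => AscentOk m k y T ∧ NoAscentLeft m k L (y :: T)

lemma noAscent_reverse_append {m k : ℕ} {L T : List (Node K)} :
    NoAscent m k (L.reverse ++ T) ↔ NoAscentLeft m k L T ∧ NoAscent m k T := by
  induction L generalizing T with
  | nil => simp [NoAscentLeft]
  | cons y L ih =>
    simp only [List.reverse_cons, List.append_assoc, List.singleton_append, ih, NoAscentLeft,
      NoAscent]
    tauto

lemma noAscentLeft_append {m k : ℕ} {A L T : List (Node K)} :
    NoAscentLeft m k (A ++ L) T ↔ NoAscentLeft m k A T ∧ NoAscentLeft m k L (A.reverse ++ T) := by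
  induction A generalizing T with
  | nil => simp [NoAscentLeft]
  | cons y A ih => simp [NoAscentLeft, ih, and_assoc]

/-- The invariant to the left of `T` survives a change of `T` to `T'` if, at every relevant height,
the change does not enlarge the prefix, or the whole interval up to the end of that prefix is light. -/
lemma NoAscentLeft.congr_right {m k : ℕ} {L T T' : List (Node K)} (hL : NoAscentLeft m k L T)
    (h : ∀ y ∈ L, prefixHits y.height T' ≤ prefixHits y.height T ∨
      (totalHits L + prefixHits y.height T') * 2 ^ k ≤ m * 2 ^ (y.height + 1)) :
    NoAscentLeft m k L T' := by
  induction L generalizing T T' with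
  | nil => trivial
  | cons y L ih =>
    obtain ⟨⟨h1, h2⟩, h3⟩ := hL
    rw [ascentPotential_eq] at h2
    refine ⟨⟨h1, ?_⟩, ih h3 fun z hz => ?_⟩
    · rw [ascentPotential_eq]
      rcases h y (by simp) with h4 | h4
      · exact (Nat.mul_le_mul_right _ (by omega)).trans h2
      · refine (Nat.mul_le_mul_right _ ?_).trans h4
        rw [totalHits_cons]; omega
    · rw [prefixHits_cons, prefixHits_cons]
      rcases h z (by simp [hz]) with h4 | h4
      · left; split_ifs <;> omega
      · right
        refine (Nat.mul_le_mul_right _ ?_).trans h4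
        rw [totalHits_cons]; split_ifs <;> omega

lemma NoAscent.height_le {m k : ℕ} {s : List (Node K)} (hs : NoAscent m k s) :
    ∀ x ∈ s, x.height ≤ k := by
  induction s with
  | nil => simp
  | cons x s ih =>
    simp only [List.mem_cons, forall_eq_or_imp]
    exact ⟨hs.1.1, ih hs.2⟩

/-! ### The cost of the backward pass -/

lemma balance_promote {m k : ℕ} {L R : List (Node K)} {u : Node K}
    (ha : AscentCondition m k u R) (hd : ¬ DescentCondition m k L u R) :
    balance m k L u R =
      ((balance m k L { u with height := u.height + 1 } R).1,
        (balance m k L { u with height := u.height + 1 } R).2 + 1) := by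
  rw [balance, if_pos ⟨ha, hd⟩]

/-- The object `u` as the backward pass leaves it when it does not promote it. -/
def settled (m k : ℕ) (L : List (Node K)) (u : Node K) (R : List (Node K)) : Node K :=
  if DescentCondition m k L u R then { u with height := u.height - 1 } else u

lemma balance_of_head {m k : ℕ} {L R : List (Node K)} {u : Node K}
    (h : ¬ (AscentCondition m k u R ∧ ¬ DescentCondition m k L u R))
    (hL : L.dropWhile (fun x => x.height < u.height) = []) :
    balance m k L u R = (L.reverse ++ settled m k L u R :: R, 1) := by
  have hsplit := takeWhile_append_of_dropWhile hL
  rw [List.append_nil] at hsplit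
  rw [balance, if_neg h]
  dsimp only
  split <;> rename_i heq
  · rw [hsplit]; rfl
  · rw [hL] at heq; cases heq

lemma balance_of_pred {m k : ℕ} {L L' R : List (Node K)} {u v : Node K}
    (h : ¬ (AscentCondition m k u R ∧ ¬ DescentCondition m k L u R))
    (hL : L.dropWhile (fun x => x.height < u.height) = v :: L') :
    balance m k L u R =
      ((balance m k L' v ((L.takeWhile (fun x => x.height < u.height)).reverse ++
          settled m k L u R :: R)).1,
        (balance m k L' v ((L.takeWhile (fun x => x.height < u.height)).reverse ++
          settled m k L u R :: R)).2 + 1) := by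
  rw [balance, if_neg h]
  dsimp only
  split <;> rename_i heq
  · rw [hL] at heq; cases heq
  · rw [hL] at heq; cases heq; rfl

lemma length_lt_of_dropWhile {h : ℕ} {L L' : List (Node K)} {v : Node K}
    (hL : L.dropWhile (fun x => x.height < h) = v :: L') : L'.length < L.length := by
  rw [← takeWhile_append_of_dropWhile hL]; simp; omega

lemma predSubtreeHits_of_pred {h : ℕ} {L L' : List (Node K)} {v : Node K}
    (hL : L.dropWhile (fun x => x.height < h) = v :: L') :
    predSubtreeHits h L = totalHits (L.takeWhile (fun x => x.height < h)) + v.hits := by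
  rw [predSubtreeHits, hL]

lemma predSubtreeHits_of_head {h : ℕ} {L : List (Node K)}
    (hL : L.dropWhile (fun x => x.height < h) = []) :
    predSubtreeHits h L = totalHits (L.takeWhile (fun x => x.height < h)) + 1 := by
  rw [predSubtreeHits, hL]

lemma predSubtreeHits_pos {h : ℕ} {L : List (Node K)} (hL : ∀ x ∈ L, 1 ≤ x.hits) :
    1 ≤ predSubtreeHits h L := by
  cases hd : L.dropWhile (fun x => x.height < h) with
  | nil => rw [predSubtreeHits_of_head hd]; omega
  | cons v L' =>
    rw [predSubtreeHits_of_pred hd]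
    have := hL v (by rw [← takeWhile_append_of_dropWhile hd]; simp)
    omega

@[simp] lemma settled_bare (m k : ℕ) (L : List (Node K)) (u : Node K) (R : List (Node K)) :
    (settled m k L u R).bare = u.bare := by
  unfold settled; split_ifs <;> rfl

@[simp] lemma settled_hits (m k : ℕ) (L : List (Node K)) (u : Node K) (R : List (Node K)) :
    (settled m k L u R).hits = u.hits := by
  unfold settled; split_ifs <;> rfl

lemma settled_height_le (m k : ℕ) (L : List (Node K)) (u : Node K) (R : List (Node K)) :
    (settled m k L u R).height ≤ u.height := by
  unfold settled; split_ifs <;> simp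

/-- The backward pass changes nothing but heights. -/
lemma balance_map_bare (m k : ℕ) (L : List (Node K)) (u : Node K) (R : List (Node K)) :
    (balance m k L u R).1.map Node.bare = (L.reverse ++ u :: R).map Node.bare := by
  by_cases h : AscentCondition m k u R ∧ ¬ DescentCondition m k L u R
  · rw [balance_promote h.1 h.2]
    exact (balance_map_bare m k L { u with height := u.height + 1 } R).trans
      (by simp [Node.bare])
  · cases hL : L.dropWhile (fun x => x.height < u.height) with
    | nil => simp [balance_of_head h hL]
    | cons v L' =>
      have hsplit := takeWhile_append_of_dropWhile hL
      rw [balance_of_pred h hL]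
      refine (balance_map_bare m k L' v _).trans ?_
      conv_rhs => rw [← hsplit]
      simp
termination_by (L.length, k - u.height)
decreasing_by
  · have := h.1.1
    exact Prod.Lex.right _ (by omega)
  · exact Prod.Lex.left _ _ (length_lt_of_dropWhile hL)

/-- The invariant while the backward pass stands at `u` between `L` and `R`: `m` and `k` belong to the
list, the objects to the right satisfy the ascent invariant, and so do the objects to the
left provided that the new hit is disregarded. As every object to the left whose interval contains
the target also has `u` in its interval, the new hit can be thought of as a hit of `u`. -/
structure BalanceInv (m k : ℕ) (L : List (Node K)) (u : Node K) (R : List (Node K)) : Prop where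
  total : totalHits L + u.hits + totalHits R = m
  level : k = Nat.log 2 m
  hits_left : ∀ x ∈ L, 1 ≤ x.hits
  hits : 1 ≤ u.hits
  height : u.height ≤ k
  left : NoAscentLeft m k L ({ u with hits := u.hits - 1 } :: R)
  right : NoAscent m k R

namespace BalanceInv

variable {m k : ℕ} {L R : List (Node K)} {u : Node K}

lemma total_pos (H : BalanceInv m k L u R) : 1 ≤ m := by
  have := H.total; have := H.hits; omega

lemma lt_two_pow (H : BalanceInv m k L u R) : m < 2 * 2 ^ k := by
  rw [H.level, ← pow_succ']
  exact Nat.lt_pow_succ_log_self one_lt_two _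

/-- A promoted object is not followed, on the way back, by another object of its original height: the
interval of the latter would contain the interval of the former and one more hit. -/
lemma lt_height_of_ascent (H : BalanceInv m k L u R) (ha : AscentCondition m k u R)
    {v : Node K} {L' : List (Node K)}
    (hL : L.dropWhile (fun x => x.height < u.height) = v :: L') : u.height < v.height := by
  refine (le_height_of_dropWhile hL).lt_of_ne fun heq => ?_
  have hsplit := takeWhile_append_of_dropWhile hL
  have h1 := H.left
  rw [← hsplit, noAscentLeft_append] at h1
  obtain ⟨-, ⟨-, h2⟩, -⟩ := h1
  have hv : 1 ≤ v.hits := H.hits_left v (by rw [← hsplit]; simp)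
  have hu := H.hits
  rw [ascentPotential_eq, prefixHits_append, prefixHits_cons, if_pos (by simp [heq])] at h2
  · have h3 := ha.2
    rw [ascentPotential_eq, heq] at h3
    have h4 : (u.hits + prefixHits v.height R) * 2 ^ k ≤ m * 2 ^ (v.height + 1) :=
      (Nat.mul_le_mul_right _ (by simp only; omega)).trans h2
    omega
  · intro x hx
    have := mem_takeWhile_height_lt (List.mem_reverse.1 hx)
    omega

lemma promote (H : BalanceInv m k L u R) (ha : AscentCondition m k u R) :
    BalanceInv m k L { u with height := u.height + 1 } R where
  total := H.total
  level := H.level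
  hits_left := H.hits_left
  hits := H.hits
  height := ha.1
  left := H.left.congr_right fun y _ => by
    left
    simp only [prefixHits_cons]
    split_ifs <;> omega
  right := H.right

lemma ascent_le (H : BalanceInv m k L u R) (ha : ¬ AscentCondition m k u R) :
    ascentPotential u R * 2 ^ k ≤ m * 2 ^ (u.height + 1) := by
  rcases H.height.lt_or_eq with h | h
  · exact not_lt.1 fun h' => ha ⟨h, h'⟩
  · have h1 : ascentPotential u R ≤ m := by
      have := H.total; have := prefixHits_le_totalHits u.height R
      rw [ascentPotential_eq]; omega
    rw [h, pow_succ]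
    have h2 := Nat.mul_le_mul_right (2 ^ k) h1
    have h3 : m * (2 ^ k * 2) = m * 2 ^ k + m * 2 ^ k := by ring
    omega

/-- An object in the bottom list is never demoted, because its subtree and the subtree of its
predecessor have at least one hit each. -/
lemma height_pos_of_descent (H : BalanceInv m k L u R) (hd : DescentCondition m k L u R) :
    1 ≤ u.height := by
  by_contra h0
  have h0 : u.height = 0 := by omega
  have h1 := predSubtreeHits_pos (h := u.height) H.hits_left
  have h2 : 1 ≤ subtreeHits u.height u R := by have := H.hits; rw [subtreeHits]; omega
  have h3 := H.lt_two_pow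
  rw [DescentCondition, h0, pow_zero, mul_one] at hd
  rw [h0] at h1 h2
  nlinarith [Nat.mul_le_mul_right (2 ^ k)
    (show 2 ≤ subtreeHits 0 u R + predSubtreeHits 0 L by omega)]

/-- The part of the list to the right of the predecessor of `u` satisfies the ascent invariant after `u`
has been demoted or left alone: a demoted `u` joins, one level lower, the intervals of objects
before it, but the descent condition says that these unions are light. -/
lemma noAscent_settled (H : BalanceInv m k L u R)
    (h : ¬ (AscentCondition m k u R ∧ ¬ DescentCondition m k L u R)) :
    NoAscent m k ((L.takeWhile (fun x => x.height < u.height)).reverse ++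
      settled m k L u R :: R) := by
  have hpart : NoAscentLeft m k (L.takeWhile (fun x => x.height < u.height))
      ({ u with hits := u.hits - 1 } :: R) := by
    have h1 := H.left
    rw [← List.takeWhile_append_dropWhile (p := fun x : Node K => decide (x.height < u.height))
      (l := L), noAscentLeft_append] at h1
    exact h1.1
  have hpred : totalHits (L.takeWhile (fun x => x.height < u.height)) ≤
      predSubtreeHits u.height L := by rw [predSubtreeHits]; omega
  rw [noAscent_reverse_append]
  by_cases hd : DescentCondition m k L u R
  · have hpos := H.height_pos_of_descent hd
    obtain ⟨n, hn⟩ : ∃ n, u.height = n + 1 := ⟨u.height - 1, by omega⟩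
    have hset : settled m k L u R = { u with height := n } := by
      rw [settled, if_pos hd, hn, Nat.add_sub_cancel]
    have hd' := hd
    rw [DescentCondition, hn, subtreeHits_succ, ← hn] at hd'
    have hb := Nat.mul_le_mul_right (2 ^ k) (show
      totalHits (L.takeWhile (fun x => x.height < u.height)) + (u.hits + prefixHits n R) ≤
      u.hits + prefixHits n R + predSubtreeHits u.height L by omega)
    have hb := hb.trans hd'
    rw [hset]
    refine ⟨hpart.congr_right fun y hy => ?_, ⟨?_, ?_⟩, H.right⟩
    · have hy := mem_takeWhile_height_lt hy
      rw [prefixHits_cons]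
      by_cases hyn : y.height = n
      · right
        rw [if_pos (by simp [hyn]), hyn, ← hn]
        exact hb
      · left
        rw [if_neg (by simp only; omega)]
        omega
    · have := H.height; simp only; omega
    · rw [ascentPotential_eq]
      simp only
      rw [← hn]
      exact (Nat.mul_le_mul_right _ (by omega)).trans hb
  · have ha : ¬ AscentCondition m k u R := fun ha => h ⟨ha, hd⟩
    rw [settled, if_neg hd]
    refine ⟨hpart.congr_right fun y hy => ?_, ⟨H.height, H.ascent_le ha⟩, H.right⟩
    have hy := mem_takeWhile_height_lt hy
    left
    rw [prefixHits_cons, if_neg (by omega)]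
    omega

lemma pred (H : BalanceInv m k L u R)
    (h : ¬ (AscentCondition m k u R ∧ ¬ DescentCondition m k L u R))
    {v : Node K} {L' : List (Node K)}
    (hL : L.dropWhile (fun x => x.height < u.height) = v :: L') :
    BalanceInv m k L' v ((L.takeWhile (fun x => x.height < u.height)).reverse ++
      settled m k L u R :: R) := by
  have hsplit := takeWhile_append_of_dropWhile hL
  have huv := le_height_of_dropWhile hL
  have hv : v ∈ L := by rw [← hsplit]; simp
  have hu := H.hits
  have hv1 := H.hits_left v hv
  have hleft := H.left
  have htot := H.total
  rw [← hsplit, totalHits_append, totalHits_cons] at htot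
  rw [← hsplit, noAscentLeft_append] at hleft
  obtain ⟨-, ⟨hvk, -⟩, hleft⟩ := hleft
  have hlow : ∀ x ∈ (L.takeWhile (fun x => x.height < u.height)).reverse,
      x.height < u.height := fun x hx =>
    mem_takeWhile_height_lt (List.mem_reverse.1 hx)
  refine ⟨?_, H.level, fun x hx => H.hits_left x (by rw [← hsplit]; simp [hx]), hv1, hvk,
    hleft.congr_right fun y _ => ?_, H.noAscent_settled h⟩
  · rw [totalHits_append, totalHits_cons, totalHits_reverse, settled_hits]; omega
  · left
    rw [prefixHits_cons, prefixHits_cons]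
    simp only
    split_ifs with hy
    · have hl : ∀ x ∈ (L.takeWhile (fun x => x.height < u.height)).reverse,
          x.height ≤ y.height := fun x hx => by have := hlow x hx; omega
      have hs := settled_height_le m k L u R
      rw [prefixHits_append hl, prefixHits_append hl, prefixHits_cons, prefixHits_cons,
        if_pos (by omega), if_pos (by simp only; omega), settled_hits]
      simp only
      omega
    · exact le_rfl

end BalanceInv

lemma pathLength_eq_of_head {h : ℕ} {L : List (Node K)}
    (hL : L.dropWhile (fun x => x.height < h) = []) : pathLength h L = 0 := by
  rw [← takeWhile_append_of_dropWhile hL, pathLength_append fun x hx => mem_takeWhile_height_lt hx]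
  rfl

lemma pathLength_eq_of_pred {h : ℕ} {L L' : List (Node K)} {v : Node K}
    (hL : L.dropWhile (fun x => x.height < h) = v :: L') :
    pathLength h L = pathLength v.height L' + 1 := by
  conv_lhs => rw [← takeWhile_append_of_dropWhile hL]
  rw [pathLength_append fun x hx => mem_takeWhile_height_lt hx,
    pathLength_cons (le_height_of_dropWhile hL)]

/-- The cost of the backward pass and of the forward pass that led to it, up to the levels above the
target, is paid by the levels and by the loss of height through demotions.
The number `f` bounds the objects of the present height that are still to be visited and that are
neither demoted nor promoted: with `b = m / 2 ^ (k - h)`, the sum of the hits of `[u, w)` and of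
the part of `[u, w)` after the subtree of `u` starts from zero, stays below `5 * b`, and grows
by more than `b` whenever such an object is passed. -/
lemma balance_cost {m k : ℕ} {L R : List (Node K)} {u : Node K} (H : BalanceInv m k L u R) (f : ℕ)
    (hf : 5 * (m * 2 ^ u.height) + subtreeHits u.height u R * 2 ^ k ≤
      2 * (ascentPotential u R * 2 ^ k) + f * (m * 2 ^ u.height)) :
    NoAscent m k (balance m k L u R).1 ∧
    2 * totalHeight (balance m k L u R).1 + pathLength u.height L + (balance m k L u R).2 ≤
      2 * (totalHeight L + u.height + totalHeight R) + 13 * (k - u.height) + 2 * f + 1 := by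
  by_cases h : AscentCondition m k u R ∧ ¬ DescentCondition m k L u R
  · have hk := h.1.1
    have ih := balance_cost (H.promote h.1) 5 (by
      have := Nat.mul_le_mul_right (2 ^ k)
        (subtreeHits_le_ascentPotential { u with height := u.height + 1 } R)
      simp only at this ⊢
      omega)
    rw [balance_promote h.1 h.2]
    have hp : pathLength u.height L = pathLength (u.height + 1) L := by
      cases hL : L.dropWhile (fun x => x.height < u.height) with
      | nil =>
        rw [pathLength_eq_of_head hL, pathLength_eq_of_head]
        rw [List.dropWhile_eq_nil_iff] at hL ⊢
        intro x hx
        have := hL x hx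
        simp only [decide_eq_true_eq] at this ⊢
        omega
      | cons v L' =>
        have hv := H.lt_height_of_ascent h.1 hL
        rw [pathLength_eq_of_pred hL, ← takeWhile_append_of_dropWhile hL,
          pathLength_append fun x hx => (mem_takeWhile_height_lt hx).trans (Nat.lt_succ_self _),
          pathLength_cons hv]
    refine ⟨ih.1, ?_⟩
    have ih := ih.2
    simp only at ih ⊢
    omega
  · have hns := H.noAscent_settled h
    cases hL : L.dropWhile (fun x => x.height < u.height) with
    | nil =>
      have hsplit := takeWhile_append_of_dropWhile hL
      rw [List.append_nil] at hsplit
      rw [balance_of_head h hL, pathLength_eq_of_head hL]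
      rw [hsplit] at hns
      refine ⟨hns, ?_⟩
      have := settled_height_le m k L u R
      simp only [totalHeight_append, totalHeight_cons, totalHeight_reverse]
      omega
    | cons v L' =>
      have hsplit := takeWhile_append_of_dropWhile hL
      have huv := le_height_of_dropWhile hL
      have Hv := H.pred h hL
      have hpred := predSubtreeHits_of_pred hL
      have htotal : totalHeight L = totalHeight (L.takeWhile (fun x => x.height < u.height)) +
          (v.height + totalHeight L') := by
        conv_lhs => rw [← hsplit]
        simp
      have hlow : ∀ x ∈ (L.takeWhile (fun x => x.height < u.height)).reverse,
          x.height < u.height := fun x hx => mem_takeWhile_height_lt (List.mem_reverse.1 hx)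
      have hvk := Hv.height
      have hsub := Nat.mul_le_mul_right (2 ^ k) (subtreeHits_le_ascentPotential v
        ((L.takeWhile (fun x => x.height < u.height)).reverse ++ settled m k L u R :: R))
      rw [balance_of_pred h hL, pathLength_eq_of_pred hL]
      set A := L.takeWhile (fun x => x.height < u.height) with hA
      -- the interval of `v` is the subtree of `v` at the time of the visit of `u`, and that of `u`
      have hPv : v.height = u.height → ascentPotential v (A.reverse ++ settled m k L u R :: R) =
          predSubtreeHits u.height L + ascentPotential u R := fun heq => by
        have hs := settled_height_le m k L u R
        rw [ascentPotential_eq, ascentPotential_eq, heq, prefixHits_append fun x hx => (hlow x hx).le,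
          prefixHits_cons, if_pos hs, settled_hits, hpred, totalHits_reverse]
        omega
      by_cases hd : DescentCondition m k L u R
      · have hpos := H.height_pos_of_descent hd
        have hset : settled m k L u R = { u with height := u.height - 1 } := by
          rw [settled, if_pos hd]
        have hh : (settled m k L u R).height + 1 = u.height := by
          rw [hset]; simp only; omega
        rcases huv.eq_or_lt with heq | hlt
        · have hCv : subtreeHits v.height v (A.reverse ++ settled m k L u R :: R) =
              predSubtreeHits u.height L + subtreeHits u.height u R := by
            rw [← heq, subtreeHits_append hlow, totalHits_reverse, hpred]
            rw [hset, subtreeHits, subtreeHits, List.takeWhile_cons_of_pos (by simp; omega),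
              totalHits_cons]
            simp only
            omega
          have ih := balance_cost Hv f (by
            rw [hCv, hPv heq.symm, ← heq]
            nlinarith [Nat.zero_le (predSubtreeHits u.height L * 2 ^ k)])
          refine ⟨ih.1, ?_⟩
          have ih := ih.2
          simp only [totalHeight_append, totalHeight_cons, totalHeight_reverse] at ih
          simp only
          omega
        · have ih := balance_cost Hv 5 (by omega)
          refine ⟨ih.1, ?_⟩
          have ih := ih.2
          simp only [totalHeight_append, totalHeight_cons, totalHeight_reverse] at ih
          simp only
          omega
      · have ha : ¬ AscentCondition m k u R := fun ha => h ⟨ha, hd⟩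
        have hset : settled m k L u R = u := by rw [settled, if_neg hd]
        rcases huv.eq_or_lt with heq | hlt
        · have hCv : subtreeHits v.height v (A.reverse ++ settled m k L u R :: R) =
              predSubtreeHits u.height L := by
            rw [← heq, subtreeHits_append hlow, totalHits_reverse, hpred, hset, subtreeHits,
              List.takeWhile_cons_of_neg (by simp)]
            simp
          have hP := H.ascent_le ha
          have hb : 1 ≤ m * 2 ^ u.height := Nat.mul_pos H.total_pos (by positivity)
          rw [pow_succ] at hP
          rw [DescentCondition, not_le] at hd
          obtain ⟨g, rfl⟩ : ∃ g, f = g + 1 := by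
            refine Nat.exists_eq_add_one.2 (Nat.pos_of_ne_zero ?_)
            rintro rfl
            nlinarith [Nat.zero_le (subtreeHits u.height u R * 2 ^ k)]
          have ih := balance_cost Hv g (by
            rw [hCv, hPv heq.symm, ← heq]
            nlinarith)
          refine ⟨ih.1, ?_⟩
          have ih := ih.2
          rw [hset] at ih ⊢
          simp only [totalHeight_append, totalHeight_cons, totalHeight_reverse] at ih
          simp only
          omega
        · have ih := balance_cost Hv 5 (by omega)
          refine ⟨ih.1, ?_⟩
          have ih := ih.2
          rw [hset] at ih ⊢
          simp only [totalHeight_append, totalHeight_cons, totalHeight_reverse] at ih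
          simp only
          omega
termination_by (L.length, k - u.height)
decreasing_by
  all_goals first
    | exact Prod.Lex.right _ (by omega)
    | exact Prod.Lex.left _ _ (length_lt_of_dropWhile hL)

/-! ### Rebuilding -/

lemma splitIndex_spec {r : ℕ} {s : List (Node K)} (h1 : 1 ≤ r) (h2 : r ≤ totalHits s) :
    ∃ x right, s.drop (splitIndex r s) = x :: right ∧ totalHits (s.take (splitIndex r s)) < r ∧
      r ≤ totalHits (s.take (splitIndex r s)) + x.hits := by
  induction s generalizing r with
  | nil => simp at h2; omega
  | cons y s ih =>
    rw [totalHits_cons] at h2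
    by_cases hy : r ≤ y.hits
    · exact ⟨y, s, by simp [splitIndex, hy], by simp [splitIndex, hy]; omega,
        by simp [splitIndex, hy]⟩
    · obtain ⟨x, right, e1, e2, e3⟩ := ih (r := r - y.hits) (by omega) (by omega)
      refine ⟨x, right, by simp [splitIndex, hy, e1], ?_, ?_⟩ <;>
        simp only [splitIndex, hy, if_false, List.take_succ_cons, totalHits_cons] <;> omega

lemma length_le_totalHits {s : List (Node K)} (hs : ∀ x ∈ s, 1 ≤ x.hits) :
    s.length ≤ totalHits s := by
  induction s with
  | nil => simp
  | cons x s ih =>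
    simp only [List.mem_cons, forall_eq_or_imp] at hs
    have := ih hs.2
    simp only [List.length_cons, totalHits_cons]
    omega

lemma build_nil : build ([] : List (Node K)) = ([], 1) := by
  rw [build]; split <;> rename_i heq
  · rfl
  · simp at heq

/-- Induction along the recursive construction: each of the two parts has at most half of the hits. -/
lemma build_induction {P : List (Node K) → State K × ℕ → Prop} (nil : P [] ([], 1))
    (node : ∀ (A : List (Node K)) (x : Node K) (B : List (Node K)) (a b : State K × ℕ),
      1 ≤ x.hits → 2 * totalHits A ≤ totalHits (A ++ x :: B) →
      2 * totalHits B ≤ totalHits (A ++ x :: B) →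
      (∀ y ∈ A, 1 ≤ y.hits) → (∀ y ∈ B, 1 ≤ y.hits) → P A a → P B b →
      P (A ++ x :: B) (a.1 ++ { x with height := Nat.log 2 (totalHits (A ++ x :: B)) } :: b.1,
        a.2 + b.2 + (Nat.log 2 (totalHits (A ++ x :: B)) + 1) + 1))
    (s : List (Node K)) (hs : ∀ x ∈ s, 1 ≤ x.hits) : P s (build s) := by
  by_cases h0 : s = []
  · rw [h0, build_nil]; exact nil
  · have hlen := length_le_totalHits hs
    have hpos := List.length_pos_of_ne_nil h0
    obtain ⟨x, B, e1, e2, e3⟩ := splitIndex_spec (r := (totalHits s + 1) / 2) (s := s)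
      (by omega) (by omega)
    have hsplit := List.take_append_drop (splitIndex ((totalHits s + 1) / 2) s) s
    have hbuild : build s =
        ((build (s.take (splitIndex ((totalHits s + 1) / 2) s))).1 ++
          { x with height := Nat.log 2 (totalHits s) } :: (build B).1,
        (build (s.take (splitIndex ((totalHits s + 1) / 2) s))).2 + (build B).2 +
          (Nat.log 2 (totalHits s) + 1) + 1) := by
      rw [build]; split <;> rename_i heq
      · rw [e1] at heq; cases heq
      · rw [e1] at heq; cases heq; rfl
    rw [hbuild]
    set A := s.take (splitIndex ((totalHits s + 1) / 2) s)
    rw [e1] at hsplit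
    have hA : A.length < s.length := by rw [← hsplit]; simp
    have hB : B.length < s.length := by rw [← hsplit]; simp; omega
    have hsA : ∀ y ∈ A, 1 ≤ y.hits := fun y hy => hs y (by rw [← hsplit]; simp [hy])
    have hsB : ∀ y ∈ B, 1 ≤ y.hits := fun y hy => hs y (by rw [← hsplit]; simp [hy])
    have ihA := build_induction nil node A hsA
    have ihB := build_induction nil node B hsB
    have htot : totalHits A + (x.hits + totalHits B) = totalHits s := by
      rw [← totalHits_cons, ← totalHits_append, hsplit]
    have := node A x B _ _ (hs x (by rw [← hsplit]; simp)) (by rw [hsplit]; omega)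
      (by rw [hsplit]; omega) hsA hsB ihA ihB
    rwa [hsplit] at this
termination_by s.length
decreasing_by
  · exact hA
  · exact hB

lemma build_map_bare {s : List (Node K)} (hs : ∀ x ∈ s, 1 ≤ x.hits) :
    (build s).1.map Node.bare = s.map Node.bare := by
  refine build_induction (P := fun s r => r.1.map Node.bare = s.map Node.bare) rfl ?_ s hs
  intro A x B a b _ _ _ _ _ hA hB
  simp [hA, hB, Node.bare]

lemma totalHeight_build_le {s : List (Node K)} (hs : ∀ x ∈ s, 1 ≤ x.hits) :
    totalHeight (build s).1 ≤ (build s).2 := by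
  refine build_induction (P := fun _ r => totalHeight r.1 ≤ r.2) (by simp) ?_ s hs
  intro A x B a b _ _ _ _ _ hA hB
  simp only [totalHeight_append, totalHeight_cons]
  omega

/-- Halving loses one level, and every hit by which a part falls short of half of the total loses at
most two more. -/
lemma log_le_log_add {H A : ℕ} (hA : 1 ≤ A) (h : 2 * A ≤ H) :
    Nat.log 2 H ≤ Nat.log 2 A + 1 + (H - 2 * A) := by
  obtain ⟨d, rfl⟩ := Nat.exists_eq_add_of_le h
  rw [Nat.add_sub_cancel_left]
  have h1 : 2 * A + d ≤ A * 2 ^ (1 + d) := by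
    have h2 : d < 2 ^ d := Nat.lt_two_pow_self
    rw [pow_add, pow_one]
    nlinarith
  refine (Nat.log_mono_right h1).trans ?_
  have : ∀ d, Nat.log 2 (A * 2 ^ d) = Nat.log 2 A + d := fun d => by
    induction d with
    | zero => simp
    | succ d ih => rw [pow_succ, ← mul_assoc, Nat.log_mul_base one_lt_two (by positivity), ih]; rfl
  rw [this]; omega

/-- The construction takes linear time. The subtracted logarithm makes the induction work. -/
lemma build_cost_aux {s : List (Node K)} (hs : ∀ x ∈ s, 1 ≤ x.hits) :
    (totalHits s = 0 ∧ (build s).2 = 1) ∨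
      (1 ≤ totalHits s ∧ (build s).2 + Nat.log 2 (totalHits s) + 4 ≤ 8 * totalHits s) := by
  refine build_induction (P := fun s r => (totalHits s = 0 ∧ r.2 = 1) ∨
      (1 ≤ totalHits s ∧ r.2 + Nat.log 2 (totalHits s) + 4 ≤ 8 * totalHits s)) (by simp) ?_ s hs
  intro A x B a b hx hA hB _ _ ihA ihB
  right
  have htot : totalHits (A ++ x :: B) = totalHits A + (x.hits + totalHits B) := by simp
  have hlog : Nat.log 2 (totalHits (A ++ x :: B)) < totalHits (A ++ x :: B) :=
    Nat.log_lt_self 2 (by omega)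
  refine ⟨by omega, ?_⟩
  rcases ihA with ⟨hA0, hA1⟩ | ⟨hA0, hA1⟩ <;> rcases ihB with ⟨hB0, hB1⟩ | ⟨hB0, hB1⟩
  · omega
  · have := log_le_log_add hB0 hB
    omega
  · have := log_le_log_add hA0 hA
    omega
  · have := log_le_log_add hB0 hB
    have := log_le_log_add hA0 hA
    omega

lemma build_cost {s : List (Node K)} (hs : ∀ x ∈ s, 1 ≤ x.hits) :
    (build s).2 ≤ 8 * totalHits s + 1 := by
  have := build_cost_aux hs
  omega

/-- Every object of a rebuilt segment lies below the next object to the right of the segment, and its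
interval is part of the segment from which its height was computed. -/
lemma noAscent_build_append {m k : ℕ} (hk : 2 ^ k ≤ m) {s : List (Node K)}
    (hs : ∀ x ∈ s, 1 ≤ x.hits) {rest : List (Node K)} (hrest : NoAscent m k rest)
    (hsk : totalHits s < 2 ^ (k + 1))
    (hhead : ∀ z ∈ rest.head?, totalHits s < 2 ^ z.height) :
    NoAscent m k ((build s).1 ++ rest) := by
  revert rest
  refine (build_induction (P := fun s r => r.1.map Node.bare = s.map Node.bare ∧
    (totalHits s < 2 ^ (k + 1) → ∀ {rest : List (Node K)}, NoAscent m k rest →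
      (∀ z ∈ rest.head?, totalHits s < 2 ^ z.height) → NoAscent m k (r.1 ++ rest))) ?_ ?_ s hs).2 hsk
  · exact ⟨rfl, fun _ rest hr _ => by simpa using hr⟩
  · rintro A x B a b hx hA hB hAs hBs ⟨hAb, ihA⟩ ⟨hBb, ihB⟩
    refine ⟨by simp [hAb, hBb, Node.bare], fun hsk rest hr hhead => ?_⟩
    set H := totalHits (A ++ x :: B) with hH
    have htot : H = totalHits A + (x.hits + totalHits B) := by rw [hH]; simp
    have hlt : H < 2 ^ (Nat.log 2 H + 1) := Nat.lt_pow_succ_log_self one_lt_two _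
    have hlogk : Nat.log 2 H ≤ k :=
      Nat.lt_succ_iff.1 ((Nat.log_lt_iff_lt_pow one_lt_two (by omega)).2 hsk)
    rw [List.append_assoc, List.cons_append]
    refine ihA (by omega) ⟨⟨hlogk, ?_⟩, ihB (by omega) hr fun z hz => by
      have := hhead z hz; omega⟩ ?_
    · have hpre : prefixHits (Nat.log 2 H) (b.1 ++ rest) ≤ totalHits B := by
        have hr0 : prefixHits (Nat.log 2 H) rest = 0 := by
          cases rest with
          | nil => rfl
          | cons z rest =>
            rw [prefixHits_cons, if_neg]
            rw [not_le]
            exact Nat.log_lt_of_lt_pow (by omega) (hhead z rfl)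
        have : ∀ l : List (Node K), prefixHits (Nat.log 2 H) (l ++ rest) ≤ totalHits l := by
          intro l
          induction l with
          | nil => simp [hr0]
          | cons y l ih =>
            rw [List.cons_append, prefixHits_cons, totalHits_cons]
            split_ifs <;> omega
        exact (this _).trans (totalHits_congr hBb).le
      rw [ascentPotential_eq, mul_comm m]
      exact Nat.mul_le_mul (by simp only; omega) hk
    · intro z hz
      simp only [List.head?_cons, Option.mem_some_iff] at hz
      rw [← hz]
      simp only
      rw [pow_succ] at hlt
      omega

/-! ### The potential -/

/-- The invariant of a splay-list between operations. The order of the keys plays no role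
for the running time. -/
structure Inv (s : State K) : Prop where
  noAscent : NoAscent (totalHits s) (topLevel s) s
  hits : ∀ x ∈ s, 1 ≤ x.hits
  hits_le : ∀ x ∈ s, x.hits ≤ x.trueHits

/-- The potential of a splay-list. The heights pay for demotions, the second term collects the cost of the
next expansion, and the last one the cost of the next rebuilding. The subtraction is truncated
only for the empty splay-list. -/
def potential (s : State K) : ℕ :=
  2 * totalHeight s + 3 * (2 * totalHits s - 2 ^ (topLevel s + 1)) + 36 * totalHits s

lemma two_pow_topLevel_le {s : State K} (hs : totalHits s ≠ 0) : 2 ^ topLevel s ≤ totalHits s :=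
  Nat.pow_log_le_self 2 hs

lemma totalHits_lt_two_pow (s : State K) : totalHits s < 2 ^ (topLevel s + 1) :=
  Nat.lt_pow_succ_log_self one_lt_two _

lemma totalHits_filter_add (s : State K) :
    totalHits (s.filter (fun x => !x.deleted)) + deletedHits s = totalHits s := by
  induction s with
  | nil => rfl
  | cons x s ih =>
    unfold deletedHits at ih ⊢
    cases hx : x.deleted <;> simp [hx] <;> omega

/-- Rebuilding only removes objects and changes heights. -/
lemma cleanup_map_bare_sublist {s : State K} (hs : ∀ x ∈ s, 1 ≤ x.hits) :
    ((cleanup s).1.map Node.bare).Sublist (s.map Node.bare) := by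
  unfold cleanup
  split_ifs
  · rw [build_map_bare fun x hx => hs x (List.mem_of_mem_filter hx)]
    exact List.filter_sublist.map _
  · exact List.Sublist.refl _

lemma cleanup_potential {s : State K} (hs : ∀ x ∈ s, 1 ≤ x.hits) :
    (cleanup s).2 + potential (cleanup s).1 ≤ potential s := by
  unfold cleanup
  split_ifs with h
  · set s' := s.filter (fun x => !x.deleted) with hs'
    have hs1 : ∀ x ∈ s', 1 ≤ x.hits := fun x hx => hs x (List.mem_of_mem_filter hx)
    have h1 : totalHits s' + deletedHits s = totalHits s := totalHits_filter_add s
    have h2 := length_le_totalHits hs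
    have h3 := build_cost hs1
    have h4 := totalHeight_build_le hs1
    have h5 := totalHits_lt_two_pow (build s').1
    have h6 := totalHits_congr (build_map_bare hs1)
    simp only [potential]
    omega
  · simp

lemma inv_of_map_bare {s t : State K} (h : s.map Node.bare = t.map Node.bare)
    (hs : NoAscent (totalHits s) (topLevel s) s) (h1 : ∀ x ∈ t, 1 ≤ x.hits)
    (h2 : ∀ x ∈ t, x.hits ≤ x.trueHits) : Inv s := by
  have key : ∀ x ∈ s, ∃ y ∈ t, y.bare = x.bare := fun x hx => by
    have : x.bare ∈ t.map Node.bare := h ▸ List.mem_map_of_mem hx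
    simpa using this
  refine ⟨hs, fun x hx => ?_, fun x hx => ?_⟩ <;>
  · obtain ⟨y, hy, hyx⟩ := key x hx
    have e1 : y.bare.hits = x.bare.hits := by rw [hyx]
    have e2 : y.bare.trueHits = x.bare.trueHits := by rw [hyx]
    simp only [Node.bare] at e1 e2
    have := h1 y hy
    have := h2 y hy
    omega

lemma Inv.cleanup {s : State K} (hs : Inv s) : Inv (cleanup s).1 := by
  unfold SplayList.cleanup
  split_ifs with h
  · set s' := s.filter (fun x => !x.deleted) with hs'
    have hs1 : ∀ x ∈ s', 1 ≤ x.hits := fun x hx => hs.hits x (List.mem_of_mem_filter hx)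
    refine inv_of_map_bare (build_map_bare hs1) ?_ hs1
      fun x hx => hs.hits_le x (List.mem_of_mem_filter hx)
    simp only
    rw [topLevel, totalHits_congr (build_map_bare hs1), ← topLevel]
    by_cases h0 : totalHits s' = 0
    · have : s' = [] := List.eq_nil_of_length_eq_zero (by
        have := length_le_totalHits hs1; omega)
      simp [this, build_nil, NoAscent]
    · have := noAscent_build_append (two_pow_topLevel_le h0) hs1 (rest := []) trivial
        (totalHits_lt_two_pow _) (by simp)
      simpa using this
  · exact hs

/-! ### Expansion -/

@[simp] lemma totalHits_expand (s : List (Node K)) : totalHits (expand s) = totalHits s := by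
  simp [totalHits, expand, Function.comp_def]

@[simp] lemma totalHeight_expand (s : List (Node K)) :
    totalHeight (expand s) = totalHeight s + s.length := by
  induction s with
  | nil => rfl
  | cons x s ih =>
    rw [expand] at ih ⊢
    simp only [List.map_cons, totalHeight_cons, ih, List.length_cons]
    omega

lemma expand_map_bare (s : List (Node K)) : (expand s).map Node.bare = s.map Node.bare := by
  simp [expand, Node.bare]

lemma pathLength_expand (h : ℕ) (L : List (Node K)) :
    pathLength (h + 1) (expand L) = pathLength h L := by
  induction L generalizing h with
  | nil => rfl
  | cons y L ih =>
    rw [expand] at ih ⊢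
    simp only [List.map_cons, pathLength, ih, Nat.add_le_add_iff_right]

lemma prefixHits_expand (h : ℕ) (R : List (Node K)) :
    prefixHits (h + 1) (expand R) = prefixHits h R := by
  induction R with
  | nil => rfl
  | cons y L ih =>
    rw [expand] at ih ⊢
    simp only [List.map_cons, prefixHits_cons, ih, Nat.add_le_add_iff_right]

/-- An expansion after one more hit does not disturb the ascent invariant: the quotients
`2 ^ (k - h)` do not change. -/
lemma AscentOk.expand {m m' k : ℕ} (hm : m ≤ m') {x : Node K} {B : List (Node K)}
    (h : AscentOk m k x B) :
    AscentOk m' (k + 1) { x with height := x.height + 1 } (expand B) := by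
  refine ⟨Nat.succ_le_succ h.1, ?_⟩
  have h2 := h.2
  rw [ascentPotential_eq] at h2 ⊢
  simp only [prefixHits_expand]
  rw [pow_succ, pow_succ _ (x.height + 1), ← mul_assoc, ← mul_assoc]
  exact Nat.mul_le_mul_right _ (h2.trans (Nat.mul_le_mul_right _ hm))

lemma AscentOk.mono {m m' k : ℕ} (hm : m ≤ m') {x : Node K} {B : List (Node K)}
    (h : AscentOk m k x B) : AscentOk m' k x B :=
  ⟨h.1, h.2.trans (Nat.mul_le_mul_right _ hm)⟩

lemma NoAscent.expand {m m' k : ℕ} (hm : m ≤ m') {s : List (Node K)} (h : NoAscent m k s) :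
    NoAscent m' (k + 1) (expand s) := by
  induction s with
  | nil => trivial
  | cons x s ih => exact ⟨h.1.expand hm, ih h.2⟩

lemma NoAscent.mono {m m' k : ℕ} (hm : m ≤ m') {s : List (Node K)} (h : NoAscent m k s) :
    NoAscent m' k s := by
  induction s with
  | nil => trivial
  | cons x s ih => exact ⟨h.1.mono hm, ih h.2⟩

lemma NoAscentLeft.expand {m m' k : ℕ} (hm : m ≤ m') {L T : List (Node K)}
    (h : NoAscentLeft m k L T) : NoAscentLeft m' (k + 1) (expand L) (expand T) := by
  induction L generalizing T with
  | nil => trivial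
  | cons x s ih => exact ⟨h.1.expand hm, ih h.2⟩

lemma NoAscentLeft.mono {m m' k : ℕ} (hm : m ≤ m') {L T : List (Node K)}
    (h : NoAscentLeft m k L T) : NoAscentLeft m' k L T := by
  induction L generalizing T with
  | nil => trivial
  | cons x s ih => exact ⟨h.1.mono hm, ih h.2⟩

lemma rebalance_map_bare (L : List (Node K)) (u : Node K) (R : List (Node K)) :
    (rebalance L u R).1.map Node.bare = (L.reverse ++ u :: R).map Node.bare := by
  unfold rebalance
  dsimp only
  split_ifs
  · rw [balance_map_bare]
    simp only [List.map_append, List.map_reverse, List.map_cons, expand_map_bare]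
    rfl
  · rw [balance_map_bare]

/-- The amortized cost of a balancing operation, apart from its rebuilding and from the level descents of
its search, where the potential before the operation is that of the list without the new hit. -/
lemma rebalance_cost {L R : List (Node K)} {u : Node K} {T : ℕ}
    (hT : T + 1 = totalHits L + u.hits + totalHits R)
    (hLh : ∀ x ∈ L, 1 ≤ x.hits) (hu : 1 ≤ u.hits) (hRh : ∀ x ∈ R, 1 ≤ x.hits)
    (huk : u.height ≤ Nat.log 2 T)
    (hL : NoAscentLeft T (Nat.log 2 T) L ({ u with hits := u.hits - 1 } :: R))
    (hR : NoAscent T (Nat.log 2 T) R) :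
    NoAscent (T + 1) (Nat.log 2 (T + 1)) (rebalance L u R).1 ∧
    (rebalance L u R).2 + pathLength u.height L + potential (rebalance L u R).1 ≤
      2 * (totalHeight L + u.height + totalHeight R) + 3 * (2 * T - 2 ^ (Nat.log 2 T + 1)) +
        36 * T + 13 * (Nat.log 2 T - u.height) + 55 := by
  have htot : totalHits (rebalance L u R).1 = T + 1 := by
    rw [totalHits_congr (rebalance_map_bare L u R), hT]; simp [add_assoc]
  have hpot : potential (rebalance L u R).1 = 2 * totalHeight (rebalance L u R).1 +
      3 * (2 * (T + 1) - 2 ^ (Nat.log 2 (T + 1) + 1)) + 36 * (T + 1) := by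
    rw [potential, topLevel, htot]
  have hlt : T < 2 ^ (Nat.log 2 T + 1) := Nat.lt_pow_succ_log_self one_lt_two _
  have hle : 2 ^ Nat.log 2 (T + 1) ≤ T + 1 := Nat.pow_log_le_self 2 (by omega)
  rw [hpot]
  unfold rebalance
  dsimp only
  rw [← hT, Nat.add_sub_cancel]
  have hmono : Nat.log 2 T ≤ Nat.log 2 (T + 1) := Nat.log_mono_right (by omega)
  split_ifs with hk
  · have hpow : 2 ^ (Nat.log 2 T + 1) ≤ 2 ^ Nat.log 2 (T + 1) := Nat.pow_le_pow_right two_pos hk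
    have hlog : Nat.log 2 (T + 1) = Nat.log 2 T + 1 := by
      refine le_antisymm ?_ hk
      have : 2 ^ Nat.log 2 (T + 1) ≤ 2 ^ (Nat.log 2 T + 1) := by omega
      exact (Nat.pow_le_pow_iff_right one_lt_two).1 this
    rw [hlog]
    have H : BalanceInv (T + 1) (Nat.log 2 T + 1) (expand L) { u with height := u.height + 1 }
        (expand R) :=
      { total := by simp [hT]
        level := hlog.symm
        hits_left := fun x hx => by
          obtain ⟨y, hy, rfl⟩ := List.mem_map.1 hx
          exact hLh y hy
        hits := hu
        height := Nat.succ_le_succ huk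
        left := hL.expand (Nat.le_succ T)
        right := hR.expand (Nat.le_succ T) }
    have hc := balance_cost H 5 (by
      have := Nat.mul_le_mul_right (2 ^ (Nat.log 2 T + 1))
        (subtreeHits_le_ascentPotential { u with height := u.height + 1 } (expand R))
      omega)
    refine ⟨hc.1, ?_⟩
    have hc := hc.2
    simp only [totalHeight_expand, pathLength_expand] at hc ⊢
    have hl1 := length_le_totalHits hLh
    have hl2 := length_le_totalHits hRh
    rw [hlog] at hle
    have hp : 2 ^ (Nat.log 2 T + 1 + 1) = 2 * 2 ^ (Nat.log 2 T + 1) := pow_succ' _ _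
    omega
  · have hlog : Nat.log 2 (T + 1) = Nat.log 2 T := by omega
    rw [hlog]
    have H : BalanceInv (T + 1) (Nat.log 2 T) L u R :=
      { total := hT.symm
        level := hlog.symm
        hits_left := hLh
        hits := hu
        height := huk
        left := hL.mono (Nat.le_succ T)
        right := hR.mono (Nat.le_succ T) }
    have hc := balance_cost H 5 (by
      have := Nat.mul_le_mul_right (2 ^ Nat.log 2 T) (subtreeHits_le_ascentPotential u R)
      omega)
    refine ⟨hc.1, ?_⟩
    have hc := hc.2
    omega

/-! ### How far the relaxed counters lag behind -/

/-- The sum of `sh² / sh'` over all objects. It pays for the operations on objects whose relaxed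
counter `sh'` is far below the true one `sh`. -/
noncomputable def lag (s : List (Node K)) : ℝ :=
  (s.map fun x => (x.trueHits : ℝ) ^ 2 / x.hits).sum

@[simp] lemma lag_nil : lag ([] : List (Node K)) = 0 := rfl

@[simp] lemma lag_cons (x : Node K) (s : List (Node K)) :
    lag (x :: s) = (x.trueHits : ℝ) ^ 2 / x.hits + lag s := by simp [lag]

@[simp] lemma lag_append (s t : List (Node K)) : lag (s ++ t) = lag s + lag t := by simp [lag]

lemma lag_map_bare (s : List (Node K)) : lag (s.map Node.bare) = lag s := by
  simp [lag, Node.bare, Function.comp_def]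

lemma lag_congr {s t : List (Node K)} (h : s.map Node.bare = t.map Node.bare) : lag s = lag t := by
  rw [← lag_map_bare s, h, lag_map_bare]

lemma lag_nonneg (s : List (Node K)) : 0 ≤ lag s := by
  refine List.sum_nonneg fun r hr => ?_
  obtain ⟨x, -, rfl⟩ := List.mem_map.1 hr
  positivity

lemma lag_le_of_sublist {s t : List (Node K)} (h : s.Sublist t) : lag s ≤ lag t := by
  induction h with
  | slnil => exact le_rfl
  | cons x _ ih => rw [lag_cons]; exact ih.trans (le_add_of_nonneg_left (by positivity))
  | cons_cons x _ ih => rw [lag_cons, lag_cons]; exact add_le_add_right ih _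

lemma lag_cleanup_le {s : List (Node K)} (hs : ∀ x ∈ s, 1 ≤ x.hits) :
    lag (cleanup s).1 ≤ lag s := by
  rw [← lag_map_bare, ← lag_map_bare s]
  exact lag_le_of_sublist (cleanup_map_bare_sublist hs)

/-- In expectation over a coin that shows heads with probability `c⁻¹`, a hit decreases `sh² / sh'` by
`sh / sh'`, up to a multiple of `c`. -/
lemma lag_drift {c t x : ℝ} (hc : 1 ≤ c) (hx : 1 ≤ x) (hxt : x ≤ t) :
    c⁻¹ * ((t + 1) ^ 2 / (x + 1)) + (1 - c⁻¹) * ((t + 1) ^ 2 / x) - t ^ 2 / x ≤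
      8 * c - t / x := by
  have hx0 : 0 < x := by linarith
  have hc0 : 0 < c := by linarith
  set r := t / x with hr
  have ht : t = r * x := by rw [hr]; field_simp
  have hr1 : 1 ≤ r := by rw [hr, le_div_iff₀ hx0]; linarith
  have e1 : (t + 1) ^ 2 / x - t ^ 2 / x ≤ 3 * r := by
    rw [hr, ← sub_div, mul_div_assoc', div_le_div_iff_of_pos_right hx0]
    nlinarith
  have e2 : r ^ 2 / 2 ≤ (t + 1) ^ 2 / x - (t + 1) ^ 2 / (x + 1) := by
    rw [div_sub_div _ _ hx0.ne' (by positivity), le_div_iff₀ (by positivity)]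
    have h1 : t ^ 2 ≤ (t + 1) ^ 2 := by nlinarith
    have h2 : r ^ 2 * x ^ 2 = t ^ 2 := by rw [ht]; ring
    nlinarith [mul_nonneg (mul_nonneg (sq_nonneg r) hx0.le) (sub_nonneg.2 hx)]
  have e3 : 4 * r - c⁻¹ * (r ^ 2 / 2) ≤ 8 * c := by
    have h1 : 0 ≤ c⁻¹ * (r - 4 * c) ^ 2 := by positivity
    have h2 : c⁻¹ * (r - 4 * c) ^ 2 = c⁻¹ * r ^ 2 - 8 * r + 16 * c := by field_simp; ring
    linarith
  have e4 := mul_le_mul_of_nonneg_left e2 (inv_nonneg.2 hc0.le)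
  linarith

/-! ### The amortized cost of one operation -/

lemma totalHits_le_totalTrueHits {s : State K} (hs : Inv s) : totalHits s ≤ totalTrueHits s :=
  List.sum_le_sum fun x hx => hs.hits_le x hx

section Step

variable [LinearOrder K]

/-- The search with which an operation begins. -/
def locate (op : Op K) (s : State K) : Located K := search op.key (topLevel s + 1) [] s

/-- The object found by an operation, with the true count and the deletion mark brought up to date and
the relaxed counter increased by `b`. -/
def visited (op : Op K) (b : ℕ) (x : Node K) : Node K :=
  { x with hits := x.hits + b, trueHits := x.trueHits + 1, deleted := op.mark x.deleted }

/-- The splay-list after a hit-operation on a physically present object, before rebuilding, and the number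
of steps of the balancing. -/
def afterHit (coin : Bool) (op : Op K) (p : Located K) (x : Node K) : State K × ℕ :=
  if coin then rebalance p.left (visited op 1 x) p.right
  else (p.left.reverse ++ visited op 0 x :: p.right, 0)

/-- The splay-list after the insertion of an absent key, before rebuilding, and the number of steps of the
balancing. -/
def afterLink (t : K) (p : Located K) : State K × ℕ := rebalance p.left ⟨t, 0, 1, 1, false⟩ p.right

lemma step_of_found {op : Op K} {s : State K} {x : Node K} (h : (locate op s).found = some x)
    (coin : Bool) :
    step coin op s = ⟨(cleanup (afterHit coin op (locate op s) x).1).1,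
      (locate op s).steps + 1 + (afterHit coin op (locate op s) x).2 +
        (cleanup (afterHit coin op (locate op s) x).1).2,
      some (totalTrueHits (afterHit coin op (locate op s) x).1, x.trueHits + 1)⟩ := by
  unfold locate at h
  unfold step
  simp only [h]
  rfl

lemma step_insert_of_absent {t : K} {s : State K} (h : (locate (.insert t) s).found = none)
    (coin : Bool) :
    step coin (.insert t) s = ⟨(cleanup (afterLink t (locate (.insert t) s)).1).1,
      (locate (.insert t) s).steps + 1 + (afterLink t (locate (.insert t) s)).2 +
        (cleanup (afterLink t (locate (.insert t) s)).1).2,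
      some (totalTrueHits (afterLink t (locate (.insert t) s)).1, 1)⟩ := by
  unfold locate at h
  unfold step
  simp only [h]
  rfl

lemma step_of_absent {op : Op K} {s : State K} (h : (locate op s).found = none)
    (hop : ∀ t, op ≠ .insert t) (coin : Bool) :
    step coin op s = ⟨s, (locate op s).steps, none⟩ := by
  unfold locate at h
  unfold step
  simp only [h]
  cases op with
  | insert t => exact absurd rfl (hop t)
  | contains t => rfl
  | delete t => rfl

lemma locate_spec {op : Op K} {s : State K} (hs : Inv s) :
    SearchSpec (topLevel s + 1) [] s (locate op s) := by
  refine search_spec _ _ _ _ (by simp) fun z hz => ?_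
  have : s.dropWhile (fun x => x.height < topLevel s + 1 + 1) = [] := by
    rw [List.dropWhile_eq_nil_iff]
    intro x hx
    have := hs.noAscent.height_le x hx
    simp only [decide_eq_true_eq]
    omega
  rw [this] at hz
  simp at hz

/-- What a hit-operation on the physically present object `x` does for either outcome of the coin. For heads,
the amortized time is linear in the depth of `x`; for tails, it is at most the time of the search,
which is a lower bound for the time in both cases. -/
structure HitCost (op : Op K) (s : State K) (x : Node K) : Prop where
  hits : 1 ≤ x.hits
  hits_le : x.hits ≤ x.trueHits
  trueHits_le : x.trueHits ≤ totalTrueHits s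
  height : x.height ≤ topLevel s
  ascent : x.hits * 2 ^ topLevel s ≤ totalHits s * 2 ^ (x.height + 1)
  inv : ∀ coin, Inv (step coin op s).state
  hit : ∀ coin, (step coin op s).hit = some (totalTrueHits s + 1, x.trueHits + 1)
  steps_ge : ∀ coin, (locate op s).steps + 1 ≤ (step coin op s).steps
  heads : (step true op s).steps + potential (step true op s).state ≤
    potential s + 14 * (topLevel s - x.height) + 58
  tails : (step false op s).steps + potential (step false op s).state ≤
    potential s + ((locate op s).steps + 1)
  lag : ∀ coin : Bool, lag (step coin op s).state ≤ lag s - (x.trueHits : ℝ) ^ 2 / x.hits +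
    ((x.trueHits : ℝ) + 1) ^ 2 / ((x.hits : ℝ) + if coin then 1 else 0)

lemma hitCost_of_found {op : Op K} {s : State K} (hs : Inv s) {x : Node K}
    (h : (locate op s).found = some x) : HitCost op s x := by
  have hspec := locate_spec (op := op) hs
  rw [SearchSpec, h] at hspec
  simp only [List.reverse_nil, List.nil_append, pathLength, add_zero] at hspec
  have hstep := step_of_found h
  set p := locate op s with hp
  obtain ⟨hxh, hsplit, hcost⟩ := hspec
  have hmem : ∀ y, y ∈ s ↔ y ∈ p.left ∨ y = x ∨ y ∈ p.right := fun y => by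
    rw [← hsplit]; simp
  have hxs : x ∈ s := (hmem x).2 (by simp)
  have hx1 := hs.hits x hxs
  have hx2 := hs.hits_le x hxs
  have hLh : ∀ y ∈ p.left, 1 ≤ y.hits := fun y hy => hs.hits y ((hmem y).2 (by simp [hy]))
  have hRh : ∀ y ∈ p.right, 1 ≤ y.hits := fun y hy => hs.hits y ((hmem y).2 (by simp [hy]))
  have hna := hs.noAscent
  rw [show NoAscent (totalHits s) (topLevel s) s =
    NoAscent (totalHits s) (topLevel s) (p.left.reverse ++ x :: p.right) by rw [hsplit],
    noAscent_reverse_append] at hna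
  obtain ⟨hnaL, ⟨hxk, hxa⟩, hnaR⟩ := hna
  have htot : totalHits s = totalHits p.left + (x.hits + totalHits p.right) := by
    conv_lhs => rw [← hsplit]
    simp
  have hheight : totalHeight s = totalHeight p.left + (x.height + totalHeight p.right) := by
    conv_lhs => rw [← hsplit]
    simp
  have htrue : totalTrueHits s =
      totalTrueHits p.left.reverse + (x.trueHits + totalTrueHits p.right) := by
    conv_lhs => rw [← hsplit]
    simp [totalTrueHits]
  have hlag : lag s = lag p.left.reverse + ((x.trueHits : ℝ) ^ 2 / x.hits + lag p.right) := by
    conv_lhs => rw [← hsplit]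
    simp
  have hpot : potential s = 2 * totalHeight s +
    3 * (2 * totalHits s - 2 ^ (Nat.log 2 (totalHits s) + 1)) + 36 * totalHits s := rfl
  have hnaL' : ∀ y : Node K, y.height = x.height → y.hits = x.hits →
      NoAscentLeft (totalHits s) (topLevel s) p.left (y :: p.right) := fun y h1 h2 =>
    hnaL.congr_right fun z _ => by left; simp [prefixHits_cons, h1, h2]
  -- the splay-list before rebuilding
  have hbare : ∀ coin : Bool, (afterHit coin op p x).1.map Node.bare =
      (p.left.reverse ++ visited op (if coin then 1 else 0) x :: p.right).map Node.bare := by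
    intro coin
    cases coin
    · rfl
    · exact rebalance_map_bare _ _ _
  have hreb := rebalance_cost (L := p.left) (u := visited op 1 x)
    (R := p.right) (T := totalHits s) (by rw [htot]; simp only [visited]; omega) hLh
    (Nat.le_add_left 1 _) hRh hxk (hnaL' _ rfl rfl) hnaR
  have hmid : ∀ coin, Inv (afterHit coin op p x).1 := by
    intro coin
    have hpos : ∀ y ∈ p.left.reverse ++ visited op (if coin then 1 else 0) x :: p.right,
        1 ≤ y.hits ∧ y.hits ≤ y.trueHits := by
      intro y hy
      simp only [List.mem_append, List.mem_reverse, List.mem_cons] at hy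
      rcases hy with hy | rfl | hy
      · exact ⟨hLh y hy, hs.hits_le y ((hmem y).2 (by simp [hy]))⟩
      · simp only [visited]; split_ifs <;> omega
      · exact ⟨hRh y hy, hs.hits_le y ((hmem y).2 (by simp [hy]))⟩
    refine inv_of_map_bare (hbare coin) ?_ (fun y hy => (hpos y hy).1) fun y hy => (hpos y hy).2
    rw [topLevel, totalHits_congr (hbare coin)]
    cases coin
    · have e : totalHits (p.left.reverse ++ visited op (if false then 1 else 0) x :: p.right) =
          totalHits s := by
        rw [htot]; simp [visited]
      rw [e]
      exact noAscent_reverse_append.2 ⟨hnaL' _ rfl rfl, ⟨hxk, hxa⟩, hnaR⟩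
    · have e : totalHits (p.left.reverse ++ visited op (if true then 1 else 0) x :: p.right) =
          totalHits s + 1 := by
        rw [htot]; simp [visited]; omega
      rw [e]
      exact hreb.1
  have hclean := fun coin => cleanup_potential (hmid coin).hits
  have hcost' : p.steps = pathLength x.height p.left + (topLevel s + 1 - x.height) + 1 := hcost
  refine ⟨hx1, hx2, by omega, hxk, ?_, fun coin => ?_, fun coin => ?_, fun coin => ?_, ?_, ?_,
    fun coin => ?_⟩
  · rw [ascentPotential_eq] at hxa
    exact (Nat.mul_le_mul_right _ (Nat.le_add_right _ _)).trans hxa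
  · rw [hstep]; exact (hmid coin).cleanup
  · rw [hstep]
    have : totalTrueHits (afterHit coin op p x).1 = totalTrueHits s + 1 := by
      rw [totalTrueHits_congr (hbare coin), htrue]
      simp [totalTrueHits, visited]
      omega
    simp only [this]
  · rw [hstep, ← hp]; simp only; omega
  · rw [hstep]
    have h1 := hclean true
    have h2 := hreb.2
    have h3 : topLevel s = Nat.log 2 (totalHits s) := rfl
    rw [show rebalance p.left (visited op 1 x) p.right = afterHit true op p x from rfl] at h2
    simp only [visited] at h2 ⊢
    omega
  · rw [hstep]
    have h1 := hclean false
    have h2 : potential (afterHit false op p x).1 = potential s := by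
      have e1 : totalHits (afterHit false op p x).1 = totalHits s := by
        rw [totalHits_congr (hbare false), htot]; simp [visited]
      rw [potential, hpot, topLevel, e1, hheight]
      simp [afterHit, visited]
    have h3 : (afterHit false op p x).2 = 0 := rfl
    rw [← hp]
    simp only
    omega
  · rw [hstep]
    refine (lag_cleanup_le (hmid coin).hits).trans ?_
    rw [lag_congr (hbare coin), hlag]
    cases coin <;> simp [visited] <;> linarith

/-- What the insertion of an absent key does; the coin plays no role. The depth of the new object is
`topLevel s`. -/
structure LinkCost (t : K) (s : State K) : Prop where
  inv : ∀ coin, Inv (step coin (.insert t) s).state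
  hit : ∀ coin, (step coin (.insert t) s).hit = some (totalTrueHits s + 1, 1)
  cost : ∀ coin, (step coin (.insert t) s).steps + potential (step coin (.insert t) s).state ≤
    potential s + 14 * topLevel s + 58
  lag : ∀ coin, lag (step coin (.insert t) s).state ≤ lag s + 1

lemma linkCost_of_absent {t : K} {s : State K} (hs : Inv s)
    (h : (locate (.insert t) s).found = none) : LinkCost t s := by
  have hspec := locate_spec (op := .insert t) hs
  rw [SearchSpec, h] at hspec
  simp only [List.reverse_nil, List.nil_append, pathLength, add_zero] at hspec
  have hstep := step_insert_of_absent h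
  set p := locate (.insert t) s with hp
  obtain ⟨hsplit, hcost⟩ := hspec
  have hmem : ∀ y, y ∈ s ↔ y ∈ p.left ∨ y ∈ p.right := fun y => by
    rw [← hsplit]; simp
  have hLh : ∀ y ∈ p.left, 1 ≤ y.hits := fun y hy => hs.hits y ((hmem y).2 (by simp [hy]))
  have hRh : ∀ y ∈ p.right, 1 ≤ y.hits := fun y hy => hs.hits y ((hmem y).2 (by simp [hy]))
  have hna := hs.noAscent
  rw [show NoAscent (totalHits s) (topLevel s) s =
    NoAscent (totalHits s) (topLevel s) (p.left.reverse ++ p.right) by rw [hsplit],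
    noAscent_reverse_append] at hna
  have htot : totalHits s = totalHits p.left + totalHits p.right := by
    conv_lhs => rw [← hsplit]
    simp
  have hheight : totalHeight s = totalHeight p.left + totalHeight p.right := by
    conv_lhs => rw [← hsplit]
    simp
  have htrue : totalTrueHits s = totalTrueHits p.left.reverse + totalTrueHits p.right := by
    conv_lhs => rw [← hsplit]
    simp [totalTrueHits]
  have hlag : lag s = lag p.left.reverse + lag p.right := by
    conv_lhs => rw [← hsplit]
    simp
  have hpot : potential s = 2 * totalHeight s +
    3 * (2 * totalHits s - 2 ^ (Nat.log 2 (totalHits s) + 1)) + 36 * totalHits s := rfl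
  have hbare : (afterLink t p).1.map Node.bare =
      (p.left.reverse ++ ⟨t, 0, 1, 1, false⟩ :: p.right).map Node.bare := by
    rw [afterLink, rebalance_map_bare]
  have hreb := rebalance_cost (L := p.left) (u := ⟨t, 0, 1, 1, false⟩) (R := p.right)
    (T := totalHits s) (by rw [htot]; simp only; omega) hLh le_rfl hRh (Nat.zero_le _)
    (hna.1.congr_right fun z _ => by left; simp [prefixHits_cons]) hna.2
  have hmid : Inv (afterLink t p).1 := by
    have hpos : ∀ y ∈ p.left.reverse ++ ⟨t, 0, 1, 1, false⟩ :: p.right,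
        1 ≤ y.hits ∧ y.hits ≤ y.trueHits := by
      intro y hy
      simp only [List.mem_append, List.mem_reverse, List.mem_cons] at hy
      rcases hy with hy | rfl | hy
      · exact ⟨hLh y hy, hs.hits_le y ((hmem y).2 (by simp [hy]))⟩
      · simp
      · exact ⟨hRh y hy, hs.hits_le y ((hmem y).2 (by simp [hy]))⟩
    refine inv_of_map_bare hbare ?_ (fun y hy => (hpos y hy).1) fun y hy => (hpos y hy).2
    have e : totalHits (afterLink t p).1 = totalHits s + 1 := by
      rw [totalHits_congr hbare, htot]; simp; omega
    rw [topLevel, e]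
    exact hreb.1
  have hclean := cleanup_potential hmid.hits
  have hcost' : p.steps = pathLength 0 p.left + (topLevel s + 1) + 1 := hcost
  refine ⟨fun coin => ?_, fun coin => ?_, fun coin => ?_, fun coin => ?_⟩
  · rw [hstep]; exact hmid.cleanup
  · rw [hstep]
    have : totalTrueHits (afterLink t p).1 = totalTrueHits s + 1 := by
      rw [totalTrueHits_congr hbare, htrue]
      simp [totalTrueHits]
      omega
    simp only [this]
  · rw [hstep]
    have h2 := hreb.2
    have h3 : topLevel s = Nat.log 2 (totalHits s) := rfl
    have h4 : rebalance p.left ⟨t, 0, 1, 1, false⟩ p.right = afterLink t p := rfl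
    rw [h4] at h2
    simp only at h2 ⊢
    omega
  · rw [hstep]
    refine (lag_cleanup_le hmid.hits).trans ?_
    rw [lag_congr hbare, hlag]
    simp only [lag_append, lag_cons]
    norm_num
    linarith

end Step

/-! ### The expected amortized cost of one operation -/

section Drift

variable [LinearOrder K]

/-- The potential that is used for the expected time. -/
noncomputable def weight (c : ℝ) (s : State K) : ℝ := c * potential s + 28 * lag s

/-- The excess of the amortized time of an operation over the claimed bound. -/
noncomputable def excess (c : ℝ) (op : Op K) (s : State K) (coin : Bool) : ℝ :=
  (step coin op s).hitTime + weight c (step coin op s).state - weight c s -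
    310 * c * (step coin op s).hitBound

lemma logb_two_le {r : ℝ} (hr : 0 < r) : Real.logb 2 r ≤ 2 * r := by
  have h1 := Real.log_two_gt_d9
  rw [Real.logb, div_le_iff₀ (by linarith)]
  have h2 := Real.log_le_sub_one_of_pos hr
  nlinarith

/-- The depth of an object in terms of the true counters and of the lag of its relaxed counter. -/
lemma HitCost.depth_le {op : Op K} {s : State K} {x : Node K} (hs : Inv s) (H : HitCost op s x) :
    ((topLevel s - x.height : ℕ) : ℝ) ≤
      Real.logb 2 ((totalTrueHits s + 1 : ℝ) / (x.trueHits + 1)) + 2 +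
        2 * ((x.trueHits : ℝ) / x.hits) := by
  have hx : (1 : ℝ) ≤ x.hits := by exact_mod_cast H.hits
  have ht : (1 : ℝ) ≤ x.trueHits := by exact_mod_cast H.hits.trans H.hits_le
  have hM : (totalHits s : ℝ) ≤ totalTrueHits s := by
    exact_mod_cast totalHits_le_totalTrueHits hs
  have hM0 : (0 : ℝ) ≤ totalTrueHits s := by positivity
  have hr : (0 : ℝ) < (x.trueHits : ℝ) / x.hits := by positivity
  have h1 : (x.hits : ℝ) * 2 ^ (topLevel s - x.height) ≤ 2 * totalHits s := by
    have h2 := H.ascent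
    obtain ⟨d, hd⟩ := Nat.exists_eq_add_of_le H.height
    rw [hd, pow_add, pow_succ] at h2
    have h3 : x.hits * 2 ^ d ≤ 2 * totalHits s := by
      refine Nat.le_of_mul_le_mul_left ?_ (Nat.two_pow_pos x.height)
      calc 2 ^ x.height * (x.hits * 2 ^ d) = x.hits * (2 ^ x.height * 2 ^ d) := by ring
        _ ≤ totalHits s * (2 ^ x.height * 2) := h2
        _ = 2 ^ x.height * (2 * totalHits s) := by ring
    rw [hd, Nat.add_sub_cancel_left]
    exact_mod_cast h3
  have h2 : (2 : ℝ) ^ (topLevel s - x.height) ≤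
      4 * (((totalTrueHits s + 1 : ℝ) / (x.trueHits + 1)) * ((x.trueHits : ℝ) / x.hits)) := by
    have : 4 * (((totalTrueHits s + 1 : ℝ) / (x.trueHits + 1)) * ((x.trueHits : ℝ) / x.hits)) =
      4 * ((totalTrueHits s + 1) * x.trueHits) / ((x.trueHits + 1) * x.hits) := by
      field_simp
    rw [this, le_div_iff₀ (by positivity)]
    calc (2 : ℝ) ^ (topLevel s - x.height) * ((x.trueHits + 1) * x.hits)
        = (x.hits * 2 ^ (topLevel s - x.height)) * (x.trueHits + 1) := by ring
      _ ≤ (2 * (totalTrueHits s + 1)) * (2 * x.trueHits) := by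
        refine mul_le_mul (by linarith) (by linarith) (by linarith) (by linarith)
      _ = 4 * ((totalTrueHits s + 1) * x.trueHits) := by ring
  have h3 := Real.logb_le_logb_of_le one_lt_two (by positivity) h2
  rw [Real.logb_pow, Real.logb_self_eq_one one_lt_two, mul_one,
    Real.logb_mul (by norm_num) (by positivity), Real.logb_mul (by positivity) (by positivity),
    show (4 : ℝ) = 2 ^ (2 : ℕ) by norm_num, Real.logb_pow, Real.logb_self_eq_one one_lt_two] at h3
  have h4 := logb_two_le hr
  push_cast at h3
  linarith

/-- A hit-operation on a present object is paid for in expectation: the search is as long when the coin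
shows tails as when it shows heads, and the amortized cost for heads is multiplied by `c`. -/
lemma excess_of_found {c : ℝ} (hc : 1 ≤ c) {op : Op K} {s : State K} (hs : Inv s) {x : Node K}
    (h : (locate op s).found = some x) :
    c⁻¹ * excess c op s true + (1 - c⁻¹) * excess c op s false ≤ 0 := by
  have H := hitCost_of_found hs h
  have hc0 : 0 < c := by linarith
  have hq : c⁻¹ * c = 1 := inv_mul_cancel₀ hc0.ne'
  have hq1 : c⁻¹ ≤ 1 := inv_le_one_of_one_le₀ hc
  have hq0 : 0 ≤ c⁻¹ := by positivity
  have hdepth := H.depth_le hs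
  have hℓ : 0 ≤ Real.logb 2 ((totalTrueHits s + 1 : ℝ) / (x.trueHits + 1)) := by
    refine Real.logb_nonneg one_lt_two ?_
    rw [one_le_div (by positivity)]
    have : (x.trueHits : ℝ) ≤ totalTrueHits s := by exact_mod_cast H.trueHits_le
    linarith
  have hdrift := lag_drift hc (x := x.hits) (t := x.trueHits) (by exact_mod_cast H.hits)
    (by exact_mod_cast H.hits_le)
  have htime : ∀ coin, (step coin op s).hitTime = (step coin op s).steps := fun coin => by
    rw [Outcome.hitTime, H.hit coin]
  have hbound : ∀ coin, (step coin op s).hitBound =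
      1 + Real.logb 2 ((totalTrueHits s + 1 : ℝ) / (x.trueHits + 1)) := fun coin => by
    rw [Outcome.hitBound, H.hit coin]; push_cast; rfl
  have hheads : ((step true op s).steps : ℝ) + potential (step true op s).state ≤
      potential s + 14 * (topLevel s - x.height : ℕ) + 58 := by exact_mod_cast H.heads
  have htails : ((step false op s).steps : ℝ) + potential (step false op s).state ≤
      potential s + ((locate op s).steps + 1) := by exact_mod_cast H.tails
  have hge : ∀ coin, ((locate op s).steps : ℝ) + 1 ≤ (step coin op s).steps := fun coin => by
    exact_mod_cast H.steps_ge coin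
  have hlag1 := H.lag true
  have hlag0 := H.lag false
  have hge1 := hge true
  have hge0 := hge false
  simp only [if_true, Bool.false_eq_true, if_false, add_zero] at hlag1 hlag0
  simp only [excess, htime, hbound, weight]
  set ℓ := Real.logb 2 ((totalTrueHits s + 1 : ℝ) / (x.trueHits + 1))
  generalize ((step true op s).steps : ℝ) = t1 at *
  generalize ((step false op s).steps : ℝ) = t0 at *
  generalize (potential (step true op s).state : ℝ) = p1 at *
  generalize (potential (step false op s).state : ℝ) = p0 at *
  generalize (potential s : ℝ) = p at *
  generalize lag (step true op s).state = l1 at *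
  generalize lag (step false op s).state = l0 at *
  generalize lag s = l at *
  generalize ((locate op s).steps : ℝ) + 1 = F at *
  -- heads and tails, weighted by their probabilities
  have e1 : c⁻¹ * t1 + (1 - c⁻¹) * t0 + (p1 - p) + (c - 1) * (p0 - p) ≤
      14 * (topLevel s - x.height : ℕ) + 58 := by
    have h1 : (1 - c⁻¹) * t0 ≤ (1 - c⁻¹) * (t1 + (p - p0)) :=
      mul_le_mul_of_nonneg_left (by linarith) (by linarith)
    have h2 : (1 - c⁻¹) * (p - p0) ≤ (c - 1) * (p - p0) :=
      mul_le_mul_of_nonneg_right (by nlinarith) (by linarith)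
    linarith
  have e2 : c⁻¹ * l1 + (1 - c⁻¹) * l0 - l ≤ 8 * c - x.trueHits / x.hits := by
    have h1 := mul_le_mul_of_nonneg_left hlag1 hq0
    have h2 := mul_le_mul_of_nonneg_left hlag0 (sub_nonneg.2 hq1)
    linarith
  have e3 : ℓ ≤ c * ℓ := le_mul_of_one_le_left hℓ hc
  have e4 : c⁻¹ * (t1 + (c * p1 + 28 * l1) - (c * p + 28 * l) - 310 * c * (1 + ℓ)) +
      (1 - c⁻¹) * (t0 + (c * p0 + 28 * l0) - (c * p + 28 * l) - 310 * c * (1 + ℓ)) =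
      (c⁻¹ * t1 + (1 - c⁻¹) * t0 + (p1 - p) + (c - 1) * (p0 - p)) +
      28 * (c⁻¹ * l1 + (1 - c⁻¹) * l0 - l) - 310 * c * (1 + ℓ) := by
    linear_combination (p1 - p0) * hq
  rw [e4]
  linarith

/-- A linked object has one hit by either count, so that its depth is within the bound for every coin. -/
lemma excess_of_link {c : ℝ} (hc : 1 ≤ c) {t : K} {s : State K} (hs : Inv s)
    (h : (locate (.insert t) s).found = none) (coin : Bool) : excess c (.insert t) s coin ≤ 0 := by
  have H := linkCost_of_absent hs h
  have htime : (step coin (.insert t) s).hitTime = (step coin (.insert t) s).steps := by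
    rw [Outcome.hitTime, H.hit coin]
  have hbound : (step coin (.insert t) s).hitBound =
      1 + Real.logb 2 (totalTrueHits s + 1) := by
    rw [Outcome.hitBound, H.hit coin]; simp
  have hk : (topLevel s : ℝ) ≤ Real.logb 2 (totalTrueHits s + 1) := by
    have h1 : 2 ^ topLevel s ≤ totalTrueHits s + 1 := by
      have := totalHits_le_totalTrueHits hs
      by_cases h0 : totalHits s = 0
      · simp [topLevel, h0]
      · have := two_pow_topLevel_le h0
        omega
    have h2 : (2 : ℝ) ^ topLevel s ≤ totalTrueHits s + 1 := by exact_mod_cast h1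
    have h3 := Real.logb_le_logb_of_le one_lt_two (by positivity) h2
    rwa [Real.logb_pow, Real.logb_self_eq_one one_lt_two, mul_one] at h3
  have hcost : ((step coin (.insert t) s).steps : ℝ) + potential (step coin (.insert t) s).state ≤
      potential s + 14 * topLevel s + 58 := by exact_mod_cast H.cost coin
  have hlag := H.lag coin
  have hk0 : (0 : ℝ) ≤ topLevel s := by positivity
  have ht0 : (0 : ℝ) ≤ (step coin (.insert t) s).steps := by positivity
  rw [excess, htime, hbound, weight, weight]
  nlinarith

lemma excess_nonpos {c : ℝ} (hc : 1 ≤ c) (op : Op K) {s : State K} (hs : Inv s) :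
    c⁻¹ * excess c op s true + (1 - c⁻¹) * excess c op s false ≤ 0 := by
  have hq1 : c⁻¹ ≤ 1 := inv_le_one_of_one_le₀ hc
  have hq0 : 0 ≤ c⁻¹ := by positivity
  cases h : (locate op s).found with
  | some x => exact excess_of_found hc hs h
  | none =>
    by_cases hop : ∃ t, op = .insert t
    · obtain ⟨t, rfl⟩ := hop
      have h1 := excess_of_link hc hs h true
      have h0 := excess_of_link hc hs h false
      nlinarith
    · push Not at hop
      simp [excess, step_of_absent h hop, Outcome.hitTime, Outcome.hitBound]

lemma inv_step (coin : Bool) (op : Op K) {s : State K} (hs : Inv s) :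
    Inv (step coin op s).state := by
  cases h : (locate op s).found with
  | some x => exact (hitCost_of_found hs h).inv coin
  | none =>
    by_cases hop : ∃ t, op = .insert t
    · obtain ⟨t, rfl⟩ := hop
      exact (linkCost_of_absent hs h).inv coin
    · push Not at hop
      rw [step_of_absent h hop]
      exact hs

lemma inv_stateAt (op : ℕ → Op K) (coin : ℕ → Bool) (i : ℕ) : Inv (stateAt op coin i) := by
  induction i with
  | zero => exact ⟨trivial, by simp [stateAt], by simp [stateAt]⟩
  | succ i ih => exact inv_step _ _ ih

lemma stateAt_congr (op : ℕ → Op K) {a b : ℕ → Bool} {i : ℕ} (h : ∀ j < i, a j = b j) :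
    stateAt op a i = stateAt op b i := by
  induction i with
  | zero => rfl
  | succ i ih =>
    rw [stateAt, stateAt, ih fun j hj => h j (by omega), h i (by omega)]

end Drift

/-! ### Expectations over the coins -/

section Coins

variable {Ω : Type*} [MeasurableSpace Ω] {P : Measure Ω} [IsProbabilityMeasure P]
  {coin : ℕ → Ω → Bool}

/-- The extension by `false` of finitely many coins. -/
def extendCoins (i : ℕ) (w : Finset.range i → Bool) (j : ℕ) : Bool :=
  if hj : j ∈ Finset.range i then w ⟨j, hj⟩ else false

lemma extendCoins_apply {i j : ℕ} (hj : j < i) (a : ℕ → Bool) :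
    extendCoins i (fun k => a k) j = a j := by
  simp [extendCoins, hj]

/-- A quantity that depends on finitely many coins only is integrable. -/
lemma integrable_of_coins (hmeas : ∀ i, Measurable (coin i)) (i : ℕ) (f : (ℕ → Bool) → ℝ)
    (hf : ∀ a b : ℕ → Bool, (∀ j < i, a j = b j) → f a = f b) :
    Integrable (fun ω => f fun j => coin j ω) P := by
  have hX : Measurable fun ω (k : Finset.range i) => coin k ω :=
    measurable_pi_lambda _ fun k => hmeas k
  have h : Integrable (fun w => f (extendCoins i w))
      (P.map fun ω (k : Finset.range i) => coin k ω) :=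
    have := Measure.isProbabilityMeasure_map (μ := P) hX.aemeasurable
    Integrable.of_finite
  refine (h.comp_measurable hX).congr (ae_of_all _ fun ω => ?_)
  exact hf _ _ fun j hj => extendCoins_apply hj fun k => coin k ω

/-- If a quantity depends on the coins before number `i` and on coin number `i`, the latter may be
averaged out. -/
lemma integral_coins_nonpos (hmeas : ∀ i, Measurable (coin i)) (hindep : iIndepFun coin P) {q : ℝ}
    (hq : ∀ i, P.real {ω | coin i ω = true} = q) (i : ℕ) (f : (ℕ → Bool) → Bool → ℝ)
    (hf : ∀ a b : ℕ → Bool, (∀ j < i, a j = b j) → f a = f b)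
    (hnonpos : ∀ a, q * f a true + (1 - q) * f a false ≤ 0) :
    ∫ ω, f (fun j => coin j ω) (coin i ω) ∂P ≤ 0 := by
  have hset : MeasurableSet {ω | coin i ω = true} := hmeas i (measurableSet_singleton true)
  -- the previous coins are independent of the indicator of heads
  have hind : ∀ g : (ℕ → Bool) → ℝ, (∀ a b : ℕ → Bool, (∀ j < i, a j = b j) → g a = g b) →
      ∫ ω, g (fun j => coin j ω) * (if coin i ω = true then 1 else 0) ∂P =
        (∫ ω, g fun j => coin j ω ∂P) * q := by
    intro g hg
    have h1 := hindep.indepFun_finset (Finset.range i) {i} (by simp) hmeas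
    have hψ : Measurable fun w : (({i} : Finset ℕ) → Bool) =>
        if w ⟨i, Finset.mem_singleton_self i⟩ = true then (1 : ℝ) else 0 := measurable_of_finite _
    have h2 := h1.comp (φ := fun w => g (extendCoins i w)) (measurable_of_finite _) hψ
    have e : (fun w => g (extendCoins i w)) ∘ (fun ω (k : Finset.range i) => coin k ω) =
        fun ω => g fun j => coin j ω := by
      funext ω
      exact hg _ _ fun j hj => extendCoins_apply hj fun k => coin k ω
    rw [e] at h2
    have h3 := h2.integral_fun_mul_eq_mul_integral
      (integrable_of_coins hmeas i g hg).aestronglyMeasurable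
      (hψ.comp (measurable_pi_lambda _ fun k => hmeas k)).aestronglyMeasurable
    simp only [Function.comp_apply] at h3
    rw [h3, ← hq i]
    congr 1
    rw [← integral_indicator_one hset]
    congr 1
    funext ω
    simp [Set.indicator_apply]
  have h1 := hind (fun a => f a true - f a false) fun a b h => by rw [hf a b h]
  have hint : ∀ b, Integrable (fun ω => f (fun j => coin j ω) b) P := fun b =>
    integrable_of_coins hmeas i (fun a => f a b) fun a a' h => by rw [hf a a' h]
  have hint' : Integrable (fun ω => (f (fun j => coin j ω) true - f (fun j => coin j ω) false) *
      (if coin i ω = true then 1 else 0)) P := by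
    refine integrable_of_coins hmeas (i + 1)
      (fun a => (f a true - f a false) * (if a i = true then 1 else 0)) fun a b h => ?_
    rw [hf a b fun j hj => h j (by omega), h i (by omega)]
  calc ∫ ω, f (fun j => coin j ω) (coin i ω) ∂P
      = ∫ ω, ((f (fun j => coin j ω) true - f (fun j => coin j ω) false) *
          (if coin i ω = true then 1 else 0) + f (fun j => coin j ω) false) ∂P := by
        congr 1
        funext ω
        cases coin i ω <;> simp
    _ = ∫ ω, (q * f (fun j => coin j ω) true + (1 - q) * f (fun j => coin j ω) false) ∂P := by
        rw [integral_add hint' (hint false), h1, integral_sub (hint true) (hint false),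
          integral_add ((hint true).const_mul _) ((hint false).const_mul _),
          integral_const_mul, integral_const_mul]
        ring
    _ ≤ 0 := integral_nonpos fun ω => hnonpos _

end Coins

end SplayList

/-! ### The expected time of a sequence of operations -/

theorem mainTheorem2 :
    ∃ C : ℝ, 0 < C ∧
      ∀ (c : ℝ), 1 ≤ c →
      ∀ (K : Type*) [LinearOrder K]
        (Ω : Type*) [MeasurableSpace Ω] (P : Measure Ω) [IsProbabilityMeasure P]
        (coin : ℕ → Ω → Bool),
        (∀ i, Measurable (coin i)) →
        iIndepFun coin P →
        (∀ i, P.real {ω | coin i ω = true} = 1 / c) →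
      ∀ (op : ℕ → SplayList.Op K) (n : ℕ),
        Integrable (fun ω => ∑ i ∈ Finset.range n,
          (SplayList.outcomeAt op (fun j => coin j ω) i).hitTime) P ∧
        ∫ ω, ∑ i ∈ Finset.range n,
            (SplayList.outcomeAt op (fun j => coin j ω) i).hitTime ∂P ≤
          ∫ ω, ∑ i ∈ Finset.range n,
            C * c * (SplayList.outcomeAt op (fun j => coin j ω) i).hitBound ∂P := by
  refine ⟨310, by norm_num, ?_⟩
  intro c hc K _ Ω _ P _ coin hmeas hindep hq op n
  have houtcome : ∀ i, ∀ a b : ℕ → Bool, (∀ j < i + 1, a j = b j) →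
      SplayList.outcomeAt op a i = SplayList.outcomeAt op b i := fun i a b h => by
    rw [SplayList.outcomeAt, SplayList.outcomeAt, h i (by omega),
      SplayList.stateAt_congr op fun j hj => h j (by omega)]
  have htime : ∀ i, Integrable
      (fun ω => (SplayList.outcomeAt op (fun j => coin j ω) i).hitTime) P := fun i =>
    SplayList.integrable_of_coins hmeas (i + 1) (fun a => (SplayList.outcomeAt op a i).hitTime)
      fun a b h => by rw [houtcome i a b h]
  have hbound : ∀ i, Integrable
      (fun ω => 310 * c * (SplayList.outcomeAt op (fun j => coin j ω) i).hitBound) P := fun i =>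
    SplayList.integrable_of_coins hmeas (i + 1)
      (fun a => 310 * c * (SplayList.outcomeAt op a i).hitBound)
      fun a b h => by rw [houtcome i a b h]
  have hweight : ∀ i, Integrable
      (fun ω => SplayList.weight c (SplayList.stateAt op (fun j => coin j ω) i)) P := fun i =>
    SplayList.integrable_of_coins hmeas i
      (fun a => SplayList.weight c (SplayList.stateAt op a i))
      fun a b h => by rw [SplayList.stateAt_congr op h]
  refine ⟨integrable_finsetSum _ fun i _ => htime i, ?_⟩
  have hstep : ∀ i,
      ∫ ω, (SplayList.outcomeAt op (fun j => coin j ω) i).hitTime ∂P +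
        ∫ ω, SplayList.weight c (SplayList.stateAt op (fun j => coin j ω) (i + 1)) ∂P ≤
      ∫ ω, 310 * c * (SplayList.outcomeAt op (fun j => coin j ω) i).hitBound ∂P +
        ∫ ω, SplayList.weight c (SplayList.stateAt op (fun j => coin j ω) i) ∂P := by
    intro i
    have h := SplayList.integral_coins_nonpos hmeas hindep hq i
      (fun a b => SplayList.excess c (op i) (SplayList.stateAt op a i) b)
      (fun a b h => by rw [SplayList.stateAt_congr op h]) fun a => by
        rw [one_div]
        exact SplayList.excess_nonpos hc (op i) (SplayList.inv_stateAt op a i)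
    have e : ∫ ω, SplayList.excess c (op i) (SplayList.stateAt op (fun j => coin j ω) i)
          (coin i ω) ∂P =
        ∫ ω, ((SplayList.outcomeAt op (fun j => coin j ω) i).hitTime +
          SplayList.weight c (SplayList.stateAt op (fun j => coin j ω) (i + 1)) -
          SplayList.weight c (SplayList.stateAt op (fun j => coin j ω) i) -
          310 * c * (SplayList.outcomeAt op (fun j => coin j ω) i).hitBound) ∂P := rfl
    have hadd : Integrable (fun ω => (SplayList.outcomeAt op (fun j => coin j ω) i).hitTime +
        SplayList.weight c (SplayList.stateAt op (fun j => coin j ω) (i + 1))) P :=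
      (htime i).add (hweight (i + 1))
    have hsub : Integrable (fun ω => (SplayList.outcomeAt op (fun j => coin j ω) i).hitTime +
        SplayList.weight c (SplayList.stateAt op (fun j => coin j ω) (i + 1)) -
        SplayList.weight c (SplayList.stateAt op (fun j => coin j ω) i)) P :=
      hadd.sub (hweight i)
    rw [e, integral_sub hsub (hbound i), integral_sub hadd (hweight i),
      integral_add (htime i) (hweight (i + 1))] at h
    linarith
  rw [integral_finsetSum _ fun i _ => htime i, integral_finsetSum _ fun i _ => hbound i]
  have hsum : ∀ n, ∑ i ∈ Finset.range n,
        ∫ ω, (SplayList.outcomeAt op (fun j => coin j ω) i).hitTime ∂P +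
        ∫ ω, SplayList.weight c (SplayList.stateAt op (fun j => coin j ω) n) ∂P ≤
      ∑ i ∈ Finset.range n,
        ∫ ω, 310 * c * (SplayList.outcomeAt op (fun j => coin j ω) i).hitBound ∂P := by
    intro n
    induction n with
    | zero =>
      simp [SplayList.stateAt, SplayList.weight, SplayList.potential, SplayList.topLevel]
    | succ n ih =>
      rw [Finset.sum_range_succ, Finset.sum_range_succ]
      have := hstep n
      linarith
  have hpos : 0 ≤ ∫ ω, SplayList.weight c (SplayList.stateAt op (fun j => coin j ω) n) ∂P :=
    integral_nonneg fun ω => add_nonneg (by positivity)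
      (mul_nonneg (by norm_num) (SplayList.lag_nonneg _))
  have := hsum n
  linarith
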